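/- Let $p,n\ge 1$ be integers, $c_p=p/n$ and $m=\min\{p,n\}$. Let $V$ be a $p\times r$ real matrix with $V'V=I_r$, let $h=(h_1,\dots,h_r)$ with $h_j\ge 0$, and put $H=\mathrm{diag}(h_1,\dots,h_r)$. Let $X$ be a $p\times n$ random matrix with independent Gaussian $N(0,I_p+VHV')$ columns. Let $\lambda_{p1}\ge\dots\ge\lambda_{pp}$ be the ordered eigenvalues of $\frac1n XX'$, and put $$S_p=\lambda_{p1}+\dots+\lambda_{pp},\qquad \lambda_p=(\lambda_{p1},\dots,\lambda_{pm}),\qquad \mu_p=(\mu_{p1},\dots,\mu_{p,m-1})\ \text{ with }\ \mu_{pi}=\lambda_{pi}/S_p .$$ Then the law of $\lambda_p$ on $\mathbb R^m$ and the law of $\mu_p$ on $\mathbb R^{m-1}$ are absolutely continuous with respect to Lebesgue measure, for the given $h$ and for $h=0$ (for $m=1$, $\mathbb R^{0}$ is a point with unit mass). Denote their densities by $f_{\lambda p}(\cdot\,;h)$ and $f_{\mu p}(\cdot\,;h)$, and consider the likelihood ratios $$L_p(h;\lambda_p)=\frac{f_{\lambda p}(\lambda_p;h)}{f_{\lambda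 p}(\lambda_p;0)},\qquad L_p(h;\mu_p)=\frac{f_{\mu p}(\mu_p;h)}{f_{\mu p}(\mu_p;0)} .$$ Let $\mathcal O(p)$ be the group of all $p\times p$ orthogonal matrices and $(\mathrm dQ)$ its invariant measure, normalized to total mass one. Put $\Lambda_p=\mathrm{diag}(\lambda_{p1},\dots,\lambda_{pp})$ and let $D_p$ be the $p\times p$ diagonal matrix $\mathrm{diag}\bigl(\frac1{2c_p}\frac{h_1}{1+h_1},\dots,\frac1{2c_p}\frac{h_r}{1+h_r},0,\dots,0\bigr)$. Then, almost surely, whether the data are drawn under the null $h=0$ or under any alternative (with any $V$ such that $V'V=I_r$ and any parameter vector with non-negative entries), $$L_p(h;\lambda_p)=\prod_{j=1}^r(1+h_j)^{-n/2}\int_{\mathcal O(p)}e^{p\,\mathrm{tr}(D_pQ'\Lambda_pQ)}(\mathrm dQ)$$ and $$L_p(h;\mu_p)=\prod_{j=1}^r(1+h_j)^{-n/2}\,\frac{(n/2)^{np/2}}{\Gamma(np/2)}\int_0^\infty x^{\frac{np}2-1}e^{-\frac n2x}\int_{\mathcal O(p)}e^{p\frac{x}{S_p}\mathrm{tr}(D_pQ'\Lambda_pQ)}(\mathrm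 dQ)\,\mathrm dx ,$$ where the integral over $x$ converges. -/

import Mathlib

open MeasureTheory Matrix

namespace SpikedCovariance

noncomputable section

/-! ### The normalized invariant measure on the orthogonal group -/

/-- The group `O(p)` of real orthogonal `p × p` matrices: over `ℝ` the star is trivial, so that the
unitary matrices are those with `Q * Qᵀ = 1` (see `mem_orthogonal_iff`). -/
abbrev Orthogonal (p : ℕ) : Type := Matrix.unitaryGroup (Fin p) ℝ

theorem mem_orthogonal_iff {p : ℕ} (Q : Matrix (Fin p) (Fin p) ℝ) :
    Q ∈ Matrix.unitaryGroup (Fin p) ℝ ↔ Q * Qᵀ = 1 := by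
  rw [Matrix.mem_unitaryGroup_iff, Matrix.star_eq_conjTranspose,
    Matrix.conjTranspose_eq_transpose_of_trivial]

instance instMeasurableSpaceOrthogonal (p : ℕ) : MeasurableSpace (Orthogonal p) :=
  borel (Orthogonal p)

instance instBorelSpaceOrthogonal (p : ℕ) : BorelSpace (Orthogonal p) := ⟨rfl⟩

instance instCompactSpaceOrthogonal (p : ℕ) : CompactSpace (Orthogonal p) := by
  have hK : IsCompact (Set.univ.pi fun _ : Fin p => Set.univ.pi fun _ : Fin p =>
      Metric.closedBall (0 : ℝ) 1) :=
    isCompact_univ_pi fun _ => isCompact_univ_pi fun _ => isCompact_closedBall 0 1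
  have hc : IsClosed {Q : Matrix (Fin p) (Fin p) ℝ | Q * Qᵀ = 1} :=
    isClosed_eq (by fun_prop) continuous_const
  refine isCompact_iff_compactSpace.mp (hK.of_isClosed_subset ?_ ?_)
  · have he : ((Matrix.unitaryGroup (Fin p) ℝ : Set (Matrix (Fin p) (Fin p) ℝ))) =
        {Q | Q * Qᵀ = 1} := Set.ext fun Q => mem_orthogonal_iff Q
    rw [he]
    exact hc
  · intro Q hQ i _ j _
    simpa using entry_norm_bound_of_unitary hQ i j

/-- The invariant (Haar) measure `(dQ)` on `O(p)`, normalized to have total mass one. -/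
def orthogonalHaar (p : ℕ) : Measure (Orthogonal p) :=
  Measure.haarMeasure ⊤

theorem orthogonalHaar_univ (p : ℕ) : orthogonalHaar p Set.univ = 1 :=
  Measure.haarMeasure_self (K₀ := (⊤ : TopologicalSpace.PositiveCompacts (Orthogonal p)))

/-- The integral `∫_{O(p)} exp (a * tr (D Q' L Q)) (dQ)`. -/
def sphericalIntegral {p : ℕ} (a : ℝ) (D L : Matrix (Fin p) (Fin p) ℝ) : ℝ :=
  ∫ Q : Orthogonal p,
    Real.exp (a * Matrix.trace (D * (Q : Matrix (Fin p) (Fin p) ℝ)ᵀ * L *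
      (Q : Matrix (Fin p) (Fin p) ℝ))) ∂(orthogonalHaar p)

/-! ### The data and the eigenvalues of the sample covariance matrix -/

/-- The space of samples: `n` columns in `ℝ^p`. -/
abbrev Sample (p n : ℕ) : Type := Fin n → EuclideanSpace ℝ (Fin p)

/-- The population covariance matrix `I_p + V H V'` with `H = diag (h_1, ..., h_r)`. -/
def populationCov {p r : ℕ} (V : Matrix (Fin p) (Fin r) ℝ) (h : Fin r → ℝ) :
    Matrix (Fin p) (Fin p) ℝ :=
  1 + V * Matrix.diagonal h * Vᵀ

/-- The law of the data: `n` independent columns with distribution `N (0, I_p + V H V')`. -/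
def dataLaw {p r : ℕ} (n : ℕ) (V : Matrix (Fin p) (Fin r) ℝ) (h : Fin r → ℝ) :
    Measure (Sample p n) :=
  Measure.pi fun _ : Fin n => ProbabilityTheory.multivariateGaussian 0 (populationCov V h)

/-- The `p × n` data matrix with the given columns. -/
def dataMatrix {p n : ℕ} (X : Sample p n) : Matrix (Fin p) (Fin n) ℝ :=
  Matrix.of fun i t => X t i

/-- The sample covariance matrix `(1 / n) X X'`. -/
def sampleCov {p n : ℕ} (X : Sample p n) : Matrix (Fin p) (Fin p) ℝ :=
  (1 / (n : ℝ)) • (dataMatrix X * (dataMatrix X)ᵀ)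

theorem sampleCov_isHermitian {p n : ℕ} (X : Sample p n) : (sampleCov X).IsHermitian := by
  simp [sampleCov, Matrix.IsHermitian, Matrix.conjTranspose_eq_transpose_of_trivial,
    Matrix.transpose_smul, Matrix.transpose_mul]

/-- The ordered eigenvalues `λ_{p1} ≥ ... ≥ λ_{pp}` of the sample covariance matrix, with
multiplicity. -/
def sampleEigenvalues {p n : ℕ} (X : Sample p n) (i : Fin p) : ℝ :=
  (sampleCov_isHermitian X).eigenvalues₀ (Fin.cast (Fintype.card_fin p).symm i)

theorem sampleEigenvalues_antitone {p n : ℕ} (X : Sample p n) : Antitone (sampleEigenvalues X) :=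
  fun _ _ hij => (sampleCov_isHermitian X).eigenvalues₀_antitone hij

/-- `S_p = λ_{p1} + ... + λ_{pp}`. -/
def eigenvalueSum {p n : ℕ} (X : Sample p n) : ℝ := ∑ i, sampleEigenvalues X i

/-- `λ_p = (λ_{p1}, ..., λ_{pm})` with `m = min (p, n)`. -/
def lambdaVec {p n : ℕ} (X : Sample p n) : Fin (min p n) → ℝ :=
  fun i => sampleEigenvalues X (Fin.castLE (min_le_left p n) i)

/-- `μ_p = (μ_{p1}, ..., μ_{p,m-1})` with `m = min (p, n)` and `μ_{pi} = λ_{pi} / S_p`. -/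
def muVec {p n : ℕ} (X : Sample p n) : Fin (min p n - 1) → ℝ :=
  fun i => sampleEigenvalues X (Fin.castLE ((Nat.sub_le _ _).trans (min_le_left p n)) i) /
    eigenvalueSum X

/-! ### Laws, densities and likelihood ratios of the eigenvalues -/

/-- The law of `λ_p`. -/
def lambdaLaw {p r : ℕ} (n : ℕ) (V : Matrix (Fin p) (Fin r) ℝ) (h : Fin r → ℝ) :
    Measure (Fin (min p n) → ℝ) :=
  (dataLaw n V h).map lambdaVec

/-- The law of `μ_p`. -/
def muLaw {p r : ℕ} (n : ℕ) (V : Matrix (Fin p) (Fin r) ℝ) (h : Fin r → ℝ) :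
    Measure (Fin (min p n - 1) → ℝ) :=
  (dataLaw n V h).map muVec

/-- The density of a measure on `ℝ^k` with respect to Lebesgue measure. -/
def density {k : ℕ} (P : Measure (Fin k → ℝ)) (x : Fin k → ℝ) : ℝ :=
  (P.rnDeriv volume x).toReal

/-- The likelihood ratio `L_p (h; x) = f_{λp} (x; h) / f_{λp} (x; 0)`. -/
def lambdaLR {p r : ℕ} (n : ℕ) (V : Matrix (Fin p) (Fin r) ℝ) (h : Fin r → ℝ)
    (x : Fin (min p n) → ℝ) : ℝ :=
  density (lambdaLaw n V h) x / density (lambdaLaw n V 0) x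

/-- The likelihood ratio `L_p (h; y) = f_{μp} (y; h) / f_{μp} (y; 0)`. -/
def muLR {p r : ℕ} (n : ℕ) (V : Matrix (Fin p) (Fin r) ℝ) (h : Fin r → ℝ)
    (y : Fin (min p n - 1) → ℝ) : ℝ :=
  density (muLaw n V h) y / density (muLaw n V 0) y

/-! ### The matrices in the formulas -/

/-- `D_p = diag (h_1 / (2 c_p (1 + h_1)), ..., h_r / (2 c_p (1 + h_r)), 0, ..., 0)`, a `p × p`
matrix, with `c_p = p / n`. -/
def spikeMatrix {r : ℕ} (p n : ℕ) (h : Fin r → ℝ) : Matrix (Fin p) (Fin p) ℝ :=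
  Matrix.diagonal fun i : Fin p =>
    if hi : (i : ℕ) < r then
      1 / (2 * ((p : ℝ) / (n : ℝ))) * (h ⟨i, hi⟩ / (1 + h ⟨i, hi⟩))
    else 0

/-- `Λ_p = diag (λ_{p1}, ..., λ_{pp})`. -/
def eigenvalueMatrix {p n : ℕ} (X : Sample p n) : Matrix (Fin p) (Fin p) ℝ :=
  Matrix.diagonal (sampleEigenvalues X)

end

end SpikedCovariance

open SpikedCovariance

namespace SpikedCovariance

open Set Filter ProbabilityTheory
open scoped Topology ENNReal NNReal MatrixOrder

/-! ### Measure theory -/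

theorem lintegral_fin_prod {k : ℕ} {E : Fin k → Type*} {mE : ∀ i, MeasurableSpace (E i)}
    (μ : ∀ i, Measure (E i)) [∀ i, SigmaFinite (μ i)] (f : ∀ i, E i → ℝ≥0∞)
    (hf : ∀ i, Measurable (f i)) :
    ∫⁻ x, ∏ i, f i (x i) ∂(Measure.pi μ) = ∏ i, ∫⁻ x, f i x ∂(μ i) := by
  induction k with
  | zero => simp [Measure.pi_empty_univ]
  | succ k ih =>
    have hm : Measurable fun x : ∀ i, E i => ∏ i, f i (x i) :=
      Finset.measurable_prod _ fun i _ => (hf i).comp (measurable_pi_apply i)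
    rw [← (measurePreserving_piFinSuccAbove μ 0).symm.lintegral_comp hm]
    simp_rw [Fin.prod_univ_succ]
    have h := lintegral_prod_mul (μ := μ 0) (ν := Measure.pi fun i => μ (Fin.succ i))
      (f := f 0) (g := fun x => ∏ i, f (Fin.succ i) (x i)) (hf 0).aemeasurable
      (Finset.measurable_prod _ fun i _ => (hf _).comp (measurable_pi_apply i)).aemeasurable
    rw [ih _ _ fun i => hf _] at h
    exact h

theorem pi_withDensity {k : ℕ} {E : Fin k → Type*} {mE : ∀ i, MeasurableSpace (E i)}
    (μ : ∀ i, Measure (E i)) [∀ i, SigmaFinite (μ i)] (f : ∀ i, E i → ℝ≥0∞)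
    (hf : ∀ i, Measurable (f i)) [∀ i, SigmaFinite ((μ i).withDensity (f i))] :
    Measure.pi (fun i => (μ i).withDensity (f i)) =
      (Measure.pi μ).withDensity fun x => ∏ i, f i (x i) := by
  refine Measure.pi_eq fun s hs => ?_
  rw [withDensity_apply _ (MeasurableSet.univ_pi hs), Measure.restrict_pi_pi,
    lintegral_fin_prod _ _ hf]
  exact Finset.prod_congr rfl fun i _ => (withDensity_apply _ (hs i)).symm

theorem lintegral_polar {E : Type*} [NormedAddCommGroup E] [NormedSpace ℝ E] [Nontrivial E]
    [FiniteDimensional ℝ E] [MeasurableSpace E] [BorelSpace E] (μ : Measure E)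
    [μ.IsAddHaarMeasure] (f : E → ℝ≥0∞) (hf : Measurable f) :
    ∫⁻ x, f x ∂μ = ∫⁻ w : Metric.sphere (0 : E) 1, ∫⁻ r in Ioi (0 : ℝ),
      ENNReal.ofReal (r ^ (Module.finrank ℝ E - 1)) * f (r • (w : E)) ∂volume ∂μ.toSphere := by
  have hm := μ.measurePreserving_homeomorphUnitSphereProd
  have h1 : ∫⁻ x, f x ∂μ = ∫⁻ x : ({0}ᶜ : Set E), f x ∂(μ.comap (↑)) := by
    rw [lintegral_subtype_comap (measurableSet_singleton _).compl f, restrict_compl_singleton]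
  have h2 : ∀ x : ({0}ᶜ : Set E), f x =
      (fun q : Metric.sphere (0 : E) 1 × Ioi (0 : ℝ) => f ((q.2 : ℝ) • (q.1 : E)))
        (homeomorphUnitSphereProd E x) := by
    intro x
    have : (x : E) = (homeomorphUnitSphereProd E).symm (homeomorphUnitSphereProd E x) := by simp
    conv_lhs => rw [this]
    rfl
  have hg : Measurable fun q : Metric.sphere (0 : E) 1 × Ioi (0 : ℝ) =>
      f ((q.2 : ℝ) • (q.1 : E)) := hf.comp (by fun_prop)
  rw [h1, lintegral_congr h2, hm.lintegral_comp hg, lintegral_prod _ hg.aemeasurable]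
  refine lintegral_congr fun w => ?_
  have hw : Measurable fun r : Ioi (0 : ℝ) => f ((r : ℝ) • (w : E)) := hf.comp (by fun_prop)
  rw [Measure.volumeIoiPow, lintegral_withDensity_eq_lintegral_mul _ (by fun_prop) hw]
  exact lintegral_subtype_comap measurableSet_Ioi
    (fun r : ℝ => ENNReal.ofReal (r ^ (Module.finrank ℝ E - 1)) * f (r • (w : E)))

theorem ae_ne_zero_of_analytic {f : ℝ → ℝ} (hf : AnalyticOnNhd ℝ f univ) {x : ℝ}
    (hx : f x ≠ 0) : ∀ᵐ t, f t ≠ 0 := by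
  have h := hf.preimage_zero_mem_codiscrete hx
  have h' := ae_restrict_le_codiscreteWithin (μ := volume) (MeasurableSet.univ (α := ℝ)) h
  rw [Measure.restrict_univ] at h'
  exact h'

theorem ae_ne_zero_of_analyticOnNhd {E : Type*} [NormedAddCommGroup E] [NormedSpace ℝ E]
    [Nontrivial E] [FiniteDimensional ℝ E] [MeasurableSpace E] [BorelSpace E] (μ : Measure E)
    [μ.IsAddHaarMeasure] {f : E → ℝ} (hf : AnalyticOnNhd ℝ f univ) {x₀ : E} (hx : f x₀ ≠ 0) :
    ∀ᵐ x ∂μ, f x ≠ 0 := by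
  have hc : Continuous f := continuousOn_univ.mp hf.continuousOn
  have hs : MeasurableSet {x : E | f (x₀ + x) = 0} :=
    (isClosed_eq (by fun_prop) continuous_const).measurableSet
  have key : μ {x : E | f (x₀ + x) = 0} = 0 := by
    rw [← lintegral_indicator_one hs,
      lintegral_polar μ _ (measurable_one.indicator hs), lintegral_eq_zero_of_ae_eq_zero]
    refine Eventually.of_forall fun w => ?_
    have ha : AnalyticOnNhd ℝ (fun r : ℝ => f (x₀ + r • (w : E))) univ := fun r _ =>
      (hf _ (mem_univ _)).fun_comp (f := fun r : ℝ => x₀ + r • (w : E)) (by fun_prop)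
    have h0 := ae_ne_zero_of_analytic ha (x := 0) (by simpa using hx)
    refine lintegral_eq_zero_of_ae_eq_zero (ae_restrict_of_ae ?_)
    filter_upwards [h0] with r hr
    simp [hr]
  have h1 : ∀ᵐ x ∂μ, f (x₀ + x) ≠ 0 := by rw [ae_iff]; simpa using key
  have h2 := (measurePreserving_add_left μ (-x₀)).quasiMeasurePreserving.ae h1
  simpa using h2

theorem measure_preimage_null_of_det_ne_zero {E : Type*} [NormedAddCommGroup E] [NormedSpace ℝ E]
    [FiniteDimensional ℝ E] [MeasurableSpace E] [BorelSpace E] (μ : Measure E)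
    [μ.IsAddHaarMeasure] {f : E → E} {f' : E → E →L[ℝ] E} (hf : ∀ x, HasFDerivAt f (f' x) x)
    {N : Set E} (hN : μ N = 0) : μ {x | f x ∈ N ∧ (f' x).det ≠ 0} = 0 := by
  set s := {x | f x ∈ N ∧ (f' x).det ≠ 0}
  have hδ : ∀ A : E →L[ℝ] E, ∃ δ : ℝ≥0, 0 < δ ∧ (A.det ≠ 0 →
      ∀ t : Set E, ApproximatesLinearOn f A t δ → μ (f '' t) = 0 → μ t = 0) := by
    intro A
    by_cases hA : A.det = 0
    · exact ⟨1, one_pos, fun h => absurd hA h⟩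
    have hm : ((Real.toNNReal (|A.det| / 2) : ℝ≥0) : ℝ≥0∞) < ENNReal.ofReal |A.det| := by
      rw [← ENNReal.ofReal, ENNReal.ofReal_lt_ofReal_iff (abs_pos.mpr hA)]
      linarith [abs_pos.mpr hA]
    obtain ⟨δ, h, h'⟩ := ((mul_le_addHaar_image_of_lt_det μ A hm).and self_mem_nhdsWithin).exists
    refine ⟨δ, h', fun _ t ht h0 => ?_⟩
    have h3 := h t f ht
    rw [h0, nonpos_iff_eq_zero, mul_eq_zero] at h3
    refine h3.resolve_left ?_
    simpa using hA
  choose δ hδ0 hδ using hδ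
  obtain ⟨t, A, -, -, hcov, happ, hA⟩ := exists_partition_approximatesLinearOn_of_hasFDerivWithinAt
    f s f' (fun x _ => (hf x).hasFDerivWithinAt) δ fun A => (hδ0 A).ne'
  rcases s.eq_empty_or_nonempty with hs | hs
  · rw [hs]; exact measure_empty
  have h1 : μ (⋃ n, s ∩ t n) = 0 := by
    refine measure_iUnion_null fun n => ?_
    obtain ⟨y, hy, hAy⟩ := hA hs n
    refine hδ (A n) (hAy ▸ hy.2) _ (happ n) (measure_mono_null ?_ hN)
    rintro _ ⟨x, hx, rfl⟩
    exact hx.1.1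
  refine measure_mono_null (fun x hx => ?_) h1
  obtain ⟨n, hn⟩ := mem_iUnion.mp (hcov hx)
  exact mem_iUnion.mpr ⟨n, hx, hn⟩

/-- A map which is analytic, and a submersion at one point, pulls null sets back to null sets. -/
theorem measure_preimage_null_of_analytic {E : Type*} [NormedAddCommGroup E] [NormedSpace ℝ E]
    [Nontrivial E] [FiniteDimensional ℝ E] [MeasurableSpace E] [BorelSpace E] (μ : Measure E)
    [μ.IsAddHaarMeasure] {k : ℕ} {f : E → Fin k → ℝ} (hf : AnalyticOnNhd ℝ f univ)
    (L : (Fin k → ℝ) →L[ℝ] E) {x₀ : E} (hx : ((fderiv ℝ f x₀).comp L).det ≠ 0)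
    {N : Set (Fin k → ℝ)} (hN : volume N = 0) : μ (f ⁻¹' N) = 0 := by
  have hdet : ∀ x, ((fderiv ℝ f x).comp L).det =
      (Matrix.of fun i j => fderiv ℝ f x (L (Pi.single j 1)) i).det := by
    intro x
    rw [ContinuousLinearMap.det, ← LinearMap.det_toMatrix']
    congr 1
  have hJ : AnalyticOnNhd ℝ (fun x => ((fderiv ℝ f x).comp L).det) univ := by
    simp_rw [hdet, Matrix.det_apply]
    intro x _
    have hent : ∀ i j, AnalyticAt ℝ (fun x => fderiv ℝ f x (L (Pi.single j 1)) i) x := by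
      intro i j
      have h1 := (hf.fderiv x (mem_univ x))
      have h2 := ((ContinuousLinearMap.proj (R := ℝ) (φ := fun _ : Fin k => ℝ) i).comp
        (ContinuousLinearMap.apply ℝ (Fin k → ℝ) (L (Pi.single j 1)))).analyticAt (fderiv ℝ f x)
      exact h2.fun_comp h1
    refine Finset.analyticAt_fun_sum _ fun σ _ => ?_
    have : AnalyticAt ℝ (fun x => ∏ i, fderiv ℝ f x (L (Pi.single i 1)) (σ i)) x :=
      Finset.analyticAt_fun_prod _ fun i _ => hent _ _
    have h3 := this.fun_const_smul (c := ((Equiv.Perm.sign σ : ℤ) : ℝ))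
    simpa [Units.smul_def] using h3
  have hae := ae_ne_zero_of_analyticOnNhd μ hJ hx
  have hJc : Continuous fun x => ((fderiv ℝ f x).comp L).det :=
    continuousOn_univ.mp hJ.continuousOn
  have hfc : Continuous f := continuousOn_univ.mp hf.continuousOn
  set N' := toMeasurable volume N
  have hN' : volume N' = 0 := by rw [measure_toMeasurable, hN]
  have hs : MeasurableSet {x | ¬ (f x ∈ N' ∧ ((fderiv ℝ f x).comp L).det ≠ 0)} :=
    ((hfc.measurable (measurableSet_toMeasurable _ _)).inter
      (hJc.measurable (measurableSet_singleton 0).compl)).compl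
  have h1 := ae_mem_of_ae_add_linearMap_mem (L : (Fin k → ℝ) →ₗ[ℝ] E) volume μ hs fun y => by
    have hd : ∀ t, HasFDerivAt (fun t => f (y + L t)) ((fderiv ℝ f (y + L t)).comp L) t := by
      intro t
      have h2 : HasFDerivAt (fun t => y + L t) L t := L.hasFDerivAt.const_add y
      exact ((hf _ (mem_univ _)).differentiableAt.hasFDerivAt).comp t h2
    have h3 := measure_preimage_null_of_det_ne_zero volume hd hN'
    rw [ae_iff]
    simpa using h3
  rw [← nonpos_iff_eq_zero]
  have h2 : ∀ᵐ x ∂μ, f x ∉ N := by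
    filter_upwards [h1, hae] with x hx1 hx2 hx3
    exact hx1 ⟨subset_toMeasurable _ _ hx3, hx2⟩
  rw [ae_iff] at h2
  simpa [preimage] using h2.le

theorem density_ratio_withDensity {k : ℕ} (P : Measure (Fin k → ℝ)) [IsFiniteMeasure P]
    (hP : P ≪ volume) {g : (Fin k → ℝ) → ℝ≥0∞} (hg : Measurable g) :
    ∀ᵐ x ∂P, density (P.withDensity g) x / density P x = (g x).toReal := by
  have h1 := Measure.rnDeriv_withDensity_left_of_absolutelyContinuous hP hg.aemeasurable
  have h2 := Measure.rnDeriv_pos hP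
  have h3 := hP.ae_le (Measure.rnDeriv_lt_top P volume)
  filter_upwards [hP.ae_le h1, h2, h3] with x hx1 hx2 hx3
  rw [density, density, hx1, ENNReal.toReal_mul, mul_div_assoc, div_self, mul_one]
  exact (ENNReal.toReal_pos hx2.ne' hx3.ne).ne'

/-! ### The spherical integral -/

theorem Orthogonal.transpose_mul {p : ℕ} (Q : Orthogonal p) :
    (Q : Matrix (Fin p) (Fin p) ℝ)ᵀ * (Q : Matrix (Fin p) (Fin p) ℝ) = 1 := by
  have h := (mem_orthogonal_iff _).mp Q.2
  exact mul_eq_one_comm.mp h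

theorem Orthogonal.mul_transpose {p : ℕ} (Q : Orthogonal p) :
    (Q : Matrix (Fin p) (Fin p) ℝ) * (Q : Matrix (Fin p) (Fin p) ℝ)ᵀ = 1 :=
  (mem_orthogonal_iff _).mp Q.2

instance instIsHaarMeasureOrthogonalHaar (p : ℕ) : (orthogonalHaar p).IsHaarMeasure := by
  unfold orthogonalHaar; infer_instance

instance instIsProbabilityMeasureOrthogonalHaar (p : ℕ) :
    IsProbabilityMeasure (orthogonalHaar p) := ⟨orthogonalHaar_univ p⟩

instance instIsMulRightInvariantOrthogonalHaar (p : ℕ) :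
    (orthogonalHaar p).IsMulRightInvariant := by
  refine ⟨fun R => ?_⟩
  have : IsProbabilityMeasure ((orthogonalHaar p).map (· * R)) :=
    Measure.isProbabilityMeasure_map (by fun_prop)
  exact Measure.isHaarMeasure_eq_of_isProbabilityMeasure _ _

theorem sphericalIntegral_conj_right {p : ℕ} (a : ℝ) (D L : Matrix (Fin p) (Fin p) ℝ)
    (R : Orthogonal p) : sphericalIntegral a D (R * L * (R : Matrix (Fin p) (Fin p) ℝ)ᵀ) =
      sphericalIntegral a D L := by
  unfold sphericalIntegral
  rw [← integral_mul_left_eq_self _ R]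
  refine integral_congr_ae (Eventually.of_forall fun Q => ?_)
  have h := R.transpose_mul
  simp only [Submonoid.coe_mul, transpose_mul]
  congr 3
  calc D * ((Q : Matrix (Fin p) (Fin p) ℝ)ᵀ * (R : Matrix (Fin p) (Fin p) ℝ)ᵀ) *
        (R * L * (R : Matrix (Fin p) (Fin p) ℝ)ᵀ) * (R * Q)
      = D * (Q : Matrix (Fin p) (Fin p) ℝ)ᵀ * ((R : Matrix (Fin p) (Fin p) ℝ)ᵀ * R) * L *
        ((R : Matrix (Fin p) (Fin p) ℝ)ᵀ * R) * Q := by simp only [Matrix.mul_assoc]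
    _ = _ := by rw [h]; simp [Matrix.mul_assoc]

theorem sphericalIntegral_conj_left {p : ℕ} (a : ℝ) (D L : Matrix (Fin p) (Fin p) ℝ)
    (R : Orthogonal p) : sphericalIntegral a
      ((R : Matrix (Fin p) (Fin p) ℝ) * D * (R : Matrix (Fin p) (Fin p) ℝ)ᵀ) L =
      sphericalIntegral a D L := by
  unfold sphericalIntegral
  conv_rhs => rw [← integral_mul_right_eq_self _ R]
  refine integral_congr_ae (Eventually.of_forall fun Q => ?_)
  simp only [Submonoid.coe_mul, transpose_mul]
  congr 2
  rw [Matrix.mul_assoc, Matrix.mul_assoc, Matrix.mul_assoc, Matrix.mul_assoc, Matrix.mul_assoc,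
    Matrix.trace_mul_comm]
  simp only [Matrix.mul_assoc]

theorem sphericalIntegral_smul_right {p : ℕ} (a c : ℝ) (D L : Matrix (Fin p) (Fin p) ℝ) :
    sphericalIntegral a D (c • L) = sphericalIntegral (a * c) D L := by
  simp [sphericalIntegral, mul_assoc]

theorem sphericalIntegral_smul_left {p : ℕ} (a c : ℝ) (D L : Matrix (Fin p) (Fin p) ℝ) :
    sphericalIntegral a (c • D) L = sphericalIntegral (a * c) D L := by
  simp [sphericalIntegral, mul_assoc]

theorem continuous_sphericalIntegral {p : ℕ} (D : Matrix (Fin p) (Fin p) ℝ) :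
    Continuous fun q : ℝ × Matrix (Fin p) (Fin p) ℝ => sphericalIntegral q.1 D q.2 := by
  unfold sphericalIntegral
  have : FirstCountableTopology (Matrix (Fin p) (Fin p) ℝ) :=
    inferInstanceAs (FirstCountableTopology (Fin p → Fin p → ℝ))
  have : LocallyCompactSpace (Matrix (Fin p) (Fin p) ℝ) :=
    inferInstanceAs (LocallyCompactSpace (Fin p → Fin p → ℝ))
  have h := continuous_parametric_integral_of_continuous (μ := orthogonalHaar p)
    (f := fun (q : ℝ × Matrix (Fin p) (Fin p) ℝ) (Q : Orthogonal p) =>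
      Real.exp (q.1 * Matrix.trace (D * (Q : Matrix (Fin p) (Fin p) ℝ)ᵀ * q.2 *
      (Q : Matrix (Fin p) (Fin p) ℝ)))) (by simp only [Function.uncurry_def]; fun_prop)
      (isCompact_univ (X := Orthogonal p))
  simpa using h

theorem sphericalIntegral_nonneg {p : ℕ} (a : ℝ) (D L : Matrix (Fin p) (Fin p) ℝ) :
    0 ≤ sphericalIntegral a D L :=
  integral_nonneg fun _ => (Real.exp_pos _).le

theorem ofReal_sphericalIntegral {p : ℕ} (a : ℝ) (D L : Matrix (Fin p) (Fin p) ℝ) :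
    ENNReal.ofReal (sphericalIntegral a D L) = ∫⁻ Q : Orthogonal p,
      ENNReal.ofReal (Real.exp (a * Matrix.trace (D * (Q : Matrix (Fin p) (Fin p) ℝ)ᵀ * L *
      (Q : Matrix (Fin p) (Fin p) ℝ)))) ∂(orthogonalHaar p) := by
  refine ofReal_integral_eq_lintegral_ofReal ?_ (Eventually.of_forall fun _ => (Real.exp_pos _).le)
  have h : Continuous fun Q : Orthogonal p => Real.exp (a * Matrix.trace
      (D * (Q : Matrix (Fin p) (Fin p) ℝ)ᵀ * L * (Q : Matrix (Fin p) (Fin p) ℝ))) := by fun_prop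
  exact h.integrable_of_hasCompactSupport (HasCompactSupport.of_compactSpace _)

/-! ### Ordered eigenvalues -/

theorem eq_of_antitone_of_prod_eq {p : ℕ} {d e : Fin p → ℝ} (hd : Antitone d) (he : Antitone e)
    (h : ∏ i, (Polynomial.X - Polynomial.C (d i)) = ∏ i, (Polynomial.X - Polynomial.C (e i))) :
    d = e := by
  have hr : ∀ f : Fin p → ℝ, (∏ i, (Polynomial.X - Polynomial.C (f i))).roots =
      ((List.ofFn f : List ℝ) : Multiset ℝ) := by
    intro f
    rw [Polynomial.roots_prod _ _ (Finset.prod_ne_zero_iff.mpr fun i _ =>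
      Polynomial.X_sub_C_ne_zero _)]
    simp [Fin.univ_val_map]
  have h1 := congrArg Polynomial.roots h
  rw [hr, hr, Multiset.coe_eq_coe] at h1
  exact List.ofFn_injective (h1.eq_of_sortedGE hd.sortedGE_ofFn he.sortedGE_ofFn)

theorem exists_orthogonal_diagonalization {p : ℕ} {A : Matrix (Fin p) (Fin p) ℝ}
    (hA : A.IsHermitian) : ∃ U : Orthogonal p, A = U *
      diagonal (fun i => hA.eigenvalues₀ (Fin.cast (Fintype.card_fin p).symm i)) *
        (U : Matrix (Fin p) (Fin p) ℝ)ᵀ := by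
  set σ : Fin p ≃ Fin p := (Fintype.equivOfCardEq (Fintype.card_fin _)).symm.trans
    (finCongr (Fintype.card_fin p)) with hσ
  have hev : ∀ i, hA.eigenvalues i =
      hA.eigenvalues₀ (Fin.cast (Fintype.card_fin p).symm (σ i)) := by
    intro i; rfl
  set W := hA.eigenvectorUnitary
  have hU : (W : Matrix (Fin p) (Fin p) ℝ).submatrix id σ.symm ∈
      Matrix.unitaryGroup (Fin p) ℝ := by
    rw [mem_orthogonal_iff, transpose_submatrix, submatrix_mul_equiv, Orthogonal.mul_transpose,
      submatrix_id_id]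
  have hd : diagonal (fun i => hA.eigenvalues₀ (Fin.cast (Fintype.card_fin p).symm i)) =
      (diagonal hA.eigenvalues).submatrix σ.symm σ.symm := by
    rw [submatrix_diagonal_equiv]
    congr 1
    funext i
    simp [hev]
  refine ⟨⟨_, hU⟩, ?_⟩
  have hs := hA.spectral_theorem
  rw [Unitary.conjStarAlgAut_apply] at hs
  rw [hd, transpose_submatrix, submatrix_mul_equiv, submatrix_mul_equiv, submatrix_id_id]
  exact hs

/-- The ordered eigenvalues of a symmetric matrix are the ordered roots of its characteristic
polynomial. -/
theorem eigenvalues₀_eq_of_charpoly {p : ℕ} {A : Matrix (Fin p) (Fin p) ℝ} (hA : A.IsHermitian)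
    {d : Fin p → ℝ} (hd : Antitone d)
    (h : A.charpoly = ∏ i, (Polynomial.X - Polynomial.C (d i))) :
    (fun i => hA.eigenvalues₀ (Fin.cast (Fintype.card_fin p).symm i)) = d := by
  refine eq_of_antitone_of_prod_eq (fun i j hij => hA.eigenvalues₀_antitone hij) hd ?_
  rw [← h]
  obtain ⟨U, hU⟩ := exists_orthogonal_diagonalization hA
  conv_rhs => rw [hU]
  rw [Matrix.charpoly_mul_comm, ← Matrix.mul_assoc, U.transpose_mul, Matrix.one_mul,
    charpoly_diagonal]

theorem charpoly_conj {p : ℕ} (U : Orthogonal p) (A : Matrix (Fin p) (Fin p) ℝ) :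
    ((U : Matrix (Fin p) (Fin p) ℝ) * A * (U : Matrix (Fin p) (Fin p) ℝ)ᵀ).charpoly =
      A.charpoly := by
  rw [Matrix.charpoly_mul_comm, ← Matrix.mul_assoc, U.transpose_mul, Matrix.one_mul]

theorem exists_sampleCov_eq {p n : ℕ} (X : Sample p n) : ∃ U : Orthogonal p,
    sampleCov X = U * eigenvalueMatrix X * (U : Matrix (Fin p) (Fin p) ℝ)ᵀ :=
  exists_orthogonal_diagonalization (sampleCov_isHermitian X)

theorem sampleCov_charpoly {p n : ℕ} (X : Sample p n) : (sampleCov X).charpoly =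
    ∏ i, (Polynomial.X - Polynomial.C (sampleEigenvalues X i)) := by
  obtain ⟨U, hU⟩ := exists_sampleCov_eq X
  rw [hU, charpoly_conj, eigenvalueMatrix, charpoly_diagonal]

theorem sampleEigenvalues_eq_of_charpoly {p n : ℕ} (X : Sample p n) {d : Fin p → ℝ}
    (hd : Antitone d) (h : (sampleCov X).charpoly = ∏ i, (Polynomial.X - Polynomial.C (d i))) :
    sampleEigenvalues X = d :=
  eigenvalues₀_eq_of_charpoly (sampleCov_isHermitian X) hd h

theorem sphericalIntegral_eigenvalueMatrix {p n : ℕ} (a : ℝ) (D : Matrix (Fin p) (Fin p) ℝ)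
    (X : Sample p n) :
    sphericalIntegral a D (eigenvalueMatrix X) = sphericalIntegral a D (sampleCov X) := by
  obtain ⟨U, hU⟩ := exists_sampleCov_eq X
  conv_rhs => rw [hU]
  rw [sphericalIntegral_conj_right]

theorem sampleEigenvalues_eq_of_conj {p n : ℕ} {X Y : Sample p n} (Q : Orthogonal p)
    (h : sampleCov Y = Q * sampleCov X * (Q : Matrix (Fin p) (Fin p) ℝ)ᵀ) :
    sampleEigenvalues Y = sampleEigenvalues X := by
  refine sampleEigenvalues_eq_of_charpoly Y (sampleEigenvalues_antitone X) ?_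
  rw [h, charpoly_conj, sampleCov_charpoly]

theorem dataMatrix_smul {p n : ℕ} (t : ℝ) (X : Sample p n) :
    dataMatrix (t • X) = t • dataMatrix X := by
  ext i j; simp [dataMatrix]

theorem sampleCov_smul {p n : ℕ} (t : ℝ) (X : Sample p n) :
    sampleCov (t • X) = t ^ 2 • sampleCov X := by
  simp only [sampleCov, dataMatrix_smul, transpose_smul, Matrix.smul_mul, Matrix.mul_smul,
    smul_smul]
  ring_nf

theorem sampleEigenvalues_smul {p n : ℕ} (t : ℝ) (X : Sample p n) :
    sampleEigenvalues (t • X) = t ^ 2 • sampleEigenvalues X := by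
  refine sampleEigenvalues_eq_of_charpoly _
    (fun i j hij => mul_le_mul_of_nonneg_left (sampleEigenvalues_antitone X hij) (sq_nonneg t)) ?_
  obtain ⟨U, hU⟩ := exists_sampleCov_eq X
  have h : sampleCov (t • X) = U * (t ^ 2 • eigenvalueMatrix X) *
      (U : Matrix (Fin p) (Fin p) ℝ)ᵀ := by
    rw [sampleCov_smul, hU, Matrix.mul_smul, Matrix.smul_mul]
  rw [h, charpoly_conj, eigenvalueMatrix, ← diagonal_smul, charpoly_diagonal]

theorem eigenvalueSum_eq_trace {p n : ℕ} (X : Sample p n) :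
    eigenvalueSum X = (sampleCov X).trace := by
  obtain ⟨U, hU⟩ := exists_sampleCov_eq X
  rw [hU, Matrix.trace_mul_comm, ← Matrix.mul_assoc, U.transpose_mul, Matrix.one_mul,
    eigenvalueMatrix, trace_diagonal, eigenvalueSum]

theorem trace_sampleCov {p n : ℕ} (X : Sample p n) :
    (sampleCov X).trace = (1 / (n : ℝ)) * ∑ t, ‖X t‖ ^ 2 := by
  rw [sampleCov, trace_smul, smul_eq_mul]
  simp only [Matrix.trace, diag_apply, Matrix.mul_apply, transpose_apply, dataMatrix, of_apply,
    EuclideanSpace.real_norm_sq_eq]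
  rw [Finset.sum_comm]
  simp only [sq]

theorem eigenvalueSum_pos {p n : ℕ} (hn : 1 ≤ n) {X : Sample p n} (hX : X ≠ 0) :
    0 < eigenvalueSum X := by
  rw [eigenvalueSum_eq_trace, trace_sampleCov]
  obtain ⟨t, ht⟩ := Function.ne_iff.mp hX
  have h1 : 0 < ∑ t, ‖X t‖ ^ 2 := Finset.sum_pos' (fun _ _ => sq_nonneg _)
    ⟨t, Finset.mem_univ _, pow_pos (norm_pos_iff.mpr ht) 2⟩
  have : (0 : ℝ) < n := by exact_mod_cast hn
  positivity

theorem sampleEigenvalues_nonneg {p n : ℕ} (X : Sample p n) (i : Fin p) :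
    0 ≤ sampleEigenvalues X i := by
  obtain ⟨U, hU⟩ := exists_sampleCov_eq X
  have h : (sampleCov X).PosSemidef := by
    have := Matrix.posSemidef_self_mul_conjTranspose (dataMatrix X)
    rw [conjTranspose_eq_transpose_of_trivial] at this
    exact this.smul (by positivity)
  have h2 := h.conjTranspose_mul_mul_same (U : Matrix (Fin p) (Fin p) ℝ)
  rw [conjTranspose_eq_transpose_of_trivial, hU] at h2
  have h3 : (U : Matrix (Fin p) (Fin p) ℝ)ᵀ * (U * eigenvalueMatrix X *
      (U : Matrix (Fin p) (Fin p) ℝ)ᵀ) * U = eigenvalueMatrix X := by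
    calc _ = ((U : Matrix (Fin p) (Fin p) ℝ)ᵀ * U) * eigenvalueMatrix X *
        ((U : Matrix (Fin p) (Fin p) ℝ)ᵀ * U) := by simp only [Matrix.mul_assoc]
      _ = _ := by rw [U.transpose_mul]; simp
  rw [h3, eigenvalueMatrix, posSemidef_diagonal_iff] at h2
  exact h2 i

theorem sampleEigenvalues_eq_zero {p n : ℕ} (X : Sample p n) (i : Fin p) (hi : n ≤ i) :
    sampleEigenvalues X i = 0 := by
  by_contra h0
  have hpos : 0 < sampleEigenvalues X i :=
    lt_of_le_of_ne (sampleEigenvalues_nonneg X i) (Ne.symm h0)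
  obtain ⟨U, hU⟩ := exists_sampleCov_eq X
  have hrank : (sampleCov X).rank ≤ n := by
    have h1 : (sampleCov X).rank ≤ (dataMatrix X).rank := by
      rw [sampleCov, ← Matrix.mul_smul]
      exact rank_mul_le_left _ _
    exact h1.trans ((rank_le_width _))
  have hrank' : (sampleCov X).rank = (eigenvalueMatrix X).rank := by
    rw [hU, rank_mul_eq_left_of_isUnit_det, rank_mul_eq_right_of_isUnit_det]
    · exact isUnit_det_of_left_inverse U.transpose_mul
    · exact isUnit_det_of_left_inverse U.mul_transpose
  rw [hrank', eigenvalueMatrix, rank_diagonal] at hrank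
  have hinj : Function.Injective fun j : Fin (i + 1) =>
      (⟨⟨j, by omega⟩, (hpos.trans_le (sampleEigenvalues_antitone X
        (Fin.mk_le_of_le_val (by omega)))).ne'⟩ : {j : Fin p // sampleEigenvalues X j ≠ 0}) := by
    intro a b hab
    simpa [Fin.ext_iff] using hab
  have := Fintype.card_le_of_injective _ hinj
  rw [Fintype.card_fin] at this
  omega

theorem continuous_sampleCov (p n : ℕ) : Continuous (sampleCov : Sample p n → _) := by
  unfold sampleCov dataMatrix
  fun_prop

theorem measurable_sampleEigenvalues (p n : ℕ) :
    Measurable (sampleEigenvalues : Sample p n → Fin p → ℝ) := by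
  have hc : IsClosed {d : Fin p → ℝ | Antitone d} := by
    simp only [Antitone, ofPred_forall]
    exact isClosed_iInter fun i => isClosed_iInter fun j => isClosed_iInter fun _ =>
      isClosed_le (continuous_apply j) (continuous_apply i)
  set g : (Fin p → ℝ) → ℕ → ℝ := fun d z => ∏ i, ((z : ℝ) - d i) with hg
  have hgc : Continuous g := by fun_prop
  have heval : ∀ (d : Fin p → ℝ) (z : ℝ),
      (∏ i, (Polynomial.X - Polynomial.C (d i))).eval z = ∏ i, (z - d i) := by
    intro d z; simp [Polynomial.eval_prod]
  have hinj : InjOn g {d | Antitone d} := by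
    intro d hd e he hde
    refine eq_of_antitone_of_prod_eq hd he (Polynomial.eq_of_infinite_eval_eq _ _
      ((infinite_range_of_injective (Nat.cast_injective (R := ℝ))).mono ?_))
    rintro _ ⟨z, rfl⟩
    rw [mem_ofPred_eq, heval, heval]
    exact congrFun hde z
  set f : Sample p n → ℕ → ℝ := fun X z => (scalar (Fin p) (z : ℝ) - sampleCov X).det with hf
  have hfc : Continuous f := by
    have := continuous_sampleCov p n
    fun_prop
  have hfg : ∀ X, f X = g (sampleEigenvalues X) := by
    intro X
    funext z
    rw [hf, hg]
    simp only
    rw [← heval, ← sampleCov_charpoly, eval_charpoly]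
  intro s hs
  have h1 : sampleEigenvalues ⁻¹' s = f ⁻¹' (g '' (s ∩ {d | Antitone d})) := by
    ext X
    constructor
    · intro hX
      exact ⟨_, ⟨hX, sampleEigenvalues_antitone X⟩, (hfg X).symm⟩
    · rintro ⟨d, ⟨hd, hd'⟩, h⟩
      rw [hfg] at h
      rw [mem_preimage, ← hinj hd' (sampleEigenvalues_antitone X) h]
      exact hd
  rw [h1]
  exact hfc.measurable ((hs.inter hc.measurableSet).image_of_continuousOn_injOn
    hgc.continuousOn (hinj.mono inter_subset_right))

theorem measurable_lambdaVec (p n : ℕ) : Measurable (lambdaVec : Sample p n → _) :=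
  measurable_pi_lambda _ fun _ => measurable_pi_iff.mp (measurable_sampleEigenvalues p n) _

theorem measurable_eigenvalueSum (p n : ℕ) : Measurable (eigenvalueSum : Sample p n → ℝ) :=
  Finset.measurable_sum _ fun _ _ =>
    measurable_pi_iff.mp (measurable_sampleEigenvalues p n) _

theorem measurable_muVec (p n : ℕ) : Measurable (muVec : Sample p n → _) :=
  measurable_pi_lambda _ fun _ =>
    (measurable_pi_iff.mp (measurable_sampleEigenvalues p n) _).div
      (measurable_eigenvalueSum p n)

/-! ### The law of the data -/

/-- The law of the data under the null hypothesis. -/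
noncomputable def nullLaw (p n : ℕ) : Measure (Sample p n) :=
  Measure.pi fun _ : Fin n => stdGaussian (EuclideanSpace ℝ (Fin p))

instance instIsProbabilityMeasureNullLaw (p n : ℕ) : IsProbabilityMeasure (nullLaw p n) := by
  unfold nullLaw; infer_instance

theorem dataLaw_zero {p r : ℕ} (n : ℕ) (V : Matrix (Fin p) (Fin r) ℝ) :
    dataLaw n V 0 = nullLaw p n := by
  simp [dataLaw, nullLaw, populationCov]

theorem stdGaussian_eq_withDensity (p : ℕ) : stdGaussian (EuclideanSpace ℝ (Fin p)) =
    volume.withDensity fun x =>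
      ENNReal.ofReal ((√(2 * Real.pi))⁻¹ ^ p * Real.exp (-‖x‖ ^ 2 / 2)) := by
  have hg : gaussianReal 0 1 = volume.withDensity (gaussianPDF 0 1) :=
    gaussianReal_of_var_ne_zero _ one_ne_zero
  have : SigmaFinite ((volume : Measure ℝ).withDensity (gaussianPDF 0 1)) := by
    rw [← hg]; infer_instance
  have hpi := pi_withDensity (fun _ : Fin p => (volume : Measure ℝ))
    (fun _ => gaussianPDF 0 1) (fun _ => measurable_gaussianPDF 0 1)
  rw [← map_pi_eq_stdGaussian, hg, hpi]
  have hm := PiLp.volume_preserving_toLp (Fin p)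
  have hφ : Measurable fun x : EuclideanSpace ℝ (Fin p) =>
      ENNReal.ofReal ((√(2 * Real.pi))⁻¹ ^ p * Real.exp (-‖x‖ ^ 2 / 2)) := by fun_prop
  ext s hs
  rw [Measure.map_apply hm.measurable hs, withDensity_apply _ (hm.measurable hs),
    withDensity_apply _ hs, ← hm.setLIntegral_comp_preimage hs hφ]
  refine lintegral_congr fun x => ?_
  simp only [gaussianPDF]
  rw [← ENNReal.ofReal_prod_of_nonneg fun i _ => gaussianPDFReal_nonneg _ _ _]
  congr 1
  simp only [gaussianPDFReal, Finset.prod_mul_distrib, Finset.prod_const, ← Real.exp_sum,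
    EuclideanSpace.real_norm_sq_eq]
  simp [Finset.sum_div, neg_div]

theorem stdGaussian_map_matrix {p : ℕ} {T S : Matrix (Fin p) (Fin p) ℝ} (hTS : T * S = 1) :
    (stdGaussian (EuclideanSpace ℝ (Fin p))).map (toEuclideanCLM (𝕜 := ℝ) T) =
      (stdGaussian (EuclideanSpace ℝ (Fin p))).withDensity fun x =>
        ENNReal.ofReal (|S.det| *
          Real.exp ((‖x‖ ^ 2 - ‖toEuclideanCLM (𝕜 := ℝ) S x‖ ^ 2) / 2)) := by
  have hST : S * T = 1 := mul_eq_one_comm.mp hTS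
  have hdet : LinearMap.det (toEuclideanLin T) = T.det := by
    rw [toEuclideanLin_eq_toLin_orthonormal, LinearMap.det_toLin]
  have hdet' : T.det * S.det = 1 := by rw [← det_mul, hTS, det_one]
  have hmap := Measure.map_linearMap_addHaar_eq_smul_addHaar
    (volume : Measure (EuclideanSpace ℝ (Fin p))) (f := toEuclideanLin T)
    (by rw [hdet]; exact left_ne_zero_of_mul_eq_one hdet')
  rw [hdet, inv_eq_of_mul_eq_one_right hdet'] at hmap
  set φ := fun x : EuclideanSpace ℝ (Fin p) =>
    ENNReal.ofReal ((√(2 * Real.pi))⁻¹ ^ p * Real.exp (-‖x‖ ^ 2 / 2)) with hφ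
  have hφm : Measurable φ := by fun_prop
  have hTm : Measurable (toEuclideanCLM (𝕜 := ℝ) T) := by fun_prop
  rw [stdGaussian_eq_withDensity, ← withDensity_mul _ hφm (by fun_prop)]
  ext s hs
  rw [Measure.map_apply hTm hs, withDensity_apply _ (hTm hs), withDensity_apply _ hs]
  have h1 : ∀ x, φ x = φ (toEuclideanCLM (𝕜 := ℝ) S (toEuclideanCLM (𝕜 := ℝ) T x)) := by
    intro x
    rw [← mul_apply_eq_comp, ← map_mul, hST, map_one,
      one_apply_eq_self]
  have h2 := setLIntegral_map (μ := volume) hs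
    (f := fun y => φ (toEuclideanCLM (𝕜 := ℝ) S y)) (by fun_prop) hTm
  rw [lintegral_congr h1, ← h2]
  change ∫⁻ y in s, _ ∂(Measure.map (toEuclideanLin T) volume) = _
  rw [hmap, Measure.restrict_smul, lintegral_smul_measure, smul_eq_mul,
    ← lintegral_const_mul _ (by fun_prop)]
  refine lintegral_congr fun x => ?_
  simp only [hφ, Pi.mul_apply]
  rw [← ENNReal.ofReal_mul (abs_nonneg _), ← ENNReal.ofReal_mul (by positivity)]
  congr 1
  rw [show -‖toEuclideanCLM (𝕜 := ℝ) S x‖ ^ 2 / 2 =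
    -‖x‖ ^ 2 / 2 + (‖x‖ ^ 2 - ‖toEuclideanCLM (𝕜 := ℝ) S x‖ ^ 2) / 2 by ring, Real.exp_add]
  ring

/-- Left multiplication of the data matrix by a square matrix. -/
noncomputable def act {p n : ℕ} (T : Matrix (Fin p) (Fin p) ℝ) (X : Sample p n) : Sample p n :=
  fun t => toEuclideanCLM (𝕜 := ℝ) T (X t)

theorem measurable_act {p n : ℕ} (T : Matrix (Fin p) (Fin p) ℝ) :
    Measurable (act T : Sample p n → Sample p n) := by
  unfold act; fun_prop

theorem dataMatrix_act {p n : ℕ} (T : Matrix (Fin p) (Fin p) ℝ) (X : Sample p n) :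
    dataMatrix (act T X) = T * dataMatrix X := by
  ext i t
  simp [dataMatrix, act, Matrix.mul_apply, mulVec, dotProduct]

theorem sampleCov_act {p n : ℕ} (T : Matrix (Fin p) (Fin p) ℝ) (X : Sample p n) :
    sampleCov (act T X) = T * sampleCov X * Tᵀ := by
  simp only [sampleCov, dataMatrix_act, transpose_mul, Matrix.mul_smul, Matrix.smul_mul,
    Matrix.mul_assoc]

theorem sum_norm_sq {p n : ℕ} (hn : 1 ≤ n) (X : Sample p n) :
    ∑ t, ‖X t‖ ^ 2 = n * (sampleCov X).trace := by
  have : (n : ℝ) ≠ 0 := by positivity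
  rw [trace_sampleCov]
  field_simp

theorem nullLaw_map_act {p n : ℕ} (hn : 1 ≤ n) {T S : Matrix (Fin p) (Fin p) ℝ}
    (hTS : T * S = 1) : (nullLaw p n).map (act T) =
      (nullLaw p n).withDensity fun X => ENNReal.ofReal (|S.det| ^ n *
        Real.exp (n / 2 * ((1 - Sᵀ * S) * sampleCov X).trace)) := by
  have h0 := stdGaussian_map_matrix hTS
  set ρ : EuclideanSpace ℝ (Fin p) → ℝ≥0∞ := fun x => ENNReal.ofReal (|S.det| *
          Real.exp ((‖x‖ ^ 2 - ‖toEuclideanCLM (𝕜 := ℝ) S x‖ ^ 2) / 2)) with hρ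
  have hρm : Measurable ρ := by fun_prop
  have hsf : SigmaFinite ((stdGaussian (EuclideanSpace ℝ (Fin p))).withDensity ρ) := by
    rw [← h0]
    have := Measure.isProbabilityMeasure_map (μ := stdGaussian (EuclideanSpace ℝ (Fin p)))
      (f := toEuclideanCLM (𝕜 := ℝ) T) (by fun_prop)
    infer_instance
  have hsf' : SigmaFinite ((stdGaussian (EuclideanSpace ℝ (Fin p))).map
    (toEuclideanCLM (𝕜 := ℝ) T)) := by rw [h0]; exact hsf
  have h1 := Measure.pi_map_pi (μ := fun _ : Fin n => stdGaussian (EuclideanSpace ℝ (Fin p)))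
    (f := fun _ => toEuclideanCLM (𝕜 := ℝ) T) (fun _ => by fun_prop)
  unfold nullLaw act
  rw [h1]
  simp_rw [h0]
  rw [pi_withDensity _ _ fun _ => hρm]
  congr 1
  funext X
  simp only [hρ]
  rw [← ENNReal.ofReal_prod_of_nonneg fun i _ => by positivity, Finset.prod_mul_distrib,
    ← Real.exp_sum, ← Finset.sum_div, Finset.sum_sub_distrib, sum_norm_sq hn X]
  have h2 := sum_norm_sq hn (act S X)
  rw [sampleCov_act, Matrix.trace_mul_comm, ← Matrix.mul_assoc] at h2
  unfold act at h2
  rw [h2, Matrix.sub_mul, trace_sub, Matrix.one_mul]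
  simp only [Finset.prod_const, Finset.card_univ, Fintype.card_fin]
  congr 3
  ring

theorem nullLaw_map_act_orthogonal {p n : ℕ} (hn : 1 ≤ n) (Q : Orthogonal p) :
    (nullLaw p n).map (act (Q : Matrix (Fin p) (Fin p) ℝ)) = nullLaw p n := by
  have h := nullLaw_map_act hn Q.mul_transpose
  have hd : |((Q : Matrix (Fin p) (Fin p) ℝ)ᵀ).det| = 1 := by
    have h1 := congrArg Matrix.det Q.mul_transpose
    rw [det_mul, det_transpose, det_one] at h1
    rw [det_transpose]
    rcases mul_self_eq_one_iff.mp h1 with h2 | h2 <;> simp [h2]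
  rw [h, hd, transpose_transpose, Q.mul_transpose]
  simp

theorem populationCov_mul {p r : ℕ} {V : Matrix (Fin p) (Fin r) ℝ} (hV : Vᵀ * V = 1)
    {h : Fin r → ℝ} (hh : ∀ j, 0 ≤ h j) :
    populationCov V h * (1 - V * diagonal (fun j => h j / (1 + h j)) * Vᵀ) = 1 := by
  set K : Matrix (Fin r) (Fin r) ℝ := diagonal (fun j => h j / (1 + h j)) with hK
  have h1 : diagonal h - K - diagonal h * K = 0 := by
    rw [hK, diagonal_mul_diagonal, diagonal_sub, diagonal_sub, ← diagonal_zero]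
    congr 1
    funext j
    have : 1 + h j ≠ 0 := by linarith [hh j]
    field_simp
    ring
  have h2 : V * diagonal h * Vᵀ * (V * K * Vᵀ) = V * (diagonal h * K) * Vᵀ := by
    calc _ = V * diagonal h * (Vᵀ * V) * K * Vᵀ := by simp only [Matrix.mul_assoc]
      _ = _ := by rw [hV]; simp only [Matrix.mul_assoc, Matrix.one_mul]
  have h3 : (1 + V * diagonal h * Vᵀ) * (1 - V * K * Vᵀ) =
      1 + V * (diagonal h - K - diagonal h * K) * Vᵀ := by
    rw [Matrix.add_mul, Matrix.one_mul, Matrix.mul_sub, Matrix.mul_one, h2]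
    simp only [Matrix.mul_sub, Matrix.sub_mul]
    abel
  rw [populationCov, h3, h1]
  simp

theorem populationCov_det {p r : ℕ} {V : Matrix (Fin p) (Fin r) ℝ} (hV : Vᵀ * V = 1)
    (h : Fin r → ℝ) : (populationCov V h).det = ∏ j, (1 + h j) := by
  rw [populationCov, Matrix.mul_assoc, det_one_add_mul_comm, Matrix.mul_assoc, hV, Matrix.mul_one,
    ← diagonal_one, diagonal_add, det_diagonal]

theorem populationCov_posSemidef {p r : ℕ} (V : Matrix (Fin p) (Fin r) ℝ)
    {h : Fin r → ℝ} (hh : ∀ j, 0 ≤ h j) : (populationCov V h).PosSemidef := by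
  have h1 : (diagonal h).PosSemidef := posSemidef_diagonal_iff.mpr hh
  have h2 := h1.mul_mul_conjTranspose_same V
  rw [conjTranspose_eq_transpose_of_trivial] at h2
  exact PosSemidef.one.add h2

/-- The density of the law of the data with respect to its law under the null hypothesis. -/
theorem dataLaw_eq_withDensity {p n r : ℕ} (hn : 1 ≤ n) {V : Matrix (Fin p) (Fin r) ℝ}
    (hV : Vᵀ * V = 1) {h : Fin r → ℝ} (hh : ∀ j, 0 ≤ h j) :
    dataLaw n V h = (nullLaw p n).withDensity fun X =>
      ENNReal.ofReal ((∏ j, (1 + h j) ^ (-(n : ℝ) / 2)) * Real.exp (n / 2 *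
        (V * diagonal (fun j => h j / (1 + h j)) * Vᵀ * sampleCov X).trace)) := by
  set M := V * diagonal (fun j => h j / (1 + h j)) * Vᵀ with hM
  set T := CFC.sqrt (populationCov V h) with hT
  have hTT : T * T = populationCov V h :=
    CFC.sqrt_mul_sqrt_self _ (populationCov_posSemidef V hh).nonneg
  have hTt : Tᵀ = T := by
    have h1 : IsSelfAdjoint T := (CFC.sqrt_nonneg (populationCov V h)).isSelfAdjoint
    rw [← conjTranspose_eq_transpose_of_trivial]
    exact h1
  have hinv := populationCov_mul hV hh
  rw [← hM] at hinv
  have hTS : T * (T * (1 - M)) = 1 := by rw [← Matrix.mul_assoc, hTT, hinv]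
  have hMt : Mᵀ = M := by
    simp only [hM, transpose_mul, transpose_transpose, diagonal_transpose, Matrix.mul_assoc]
  have hSS : (T * (1 - M))ᵀ * (T * (1 - M)) = 1 - M := by
    rw [transpose_mul, transpose_sub, transpose_one, hMt, hTt]
    calc _ = (1 - M) * (T * T * (1 - M)) := by simp only [Matrix.mul_assoc]
      _ = _ := by rw [hTT, hinv, Matrix.mul_one]
  have hdet : |(T * (1 - M)).det| = ∏ j, (1 + h j) ^ (-(1 : ℝ) / 2) := by
    have h1 : T.det ^ 2 = ∏ j, (1 + h j) := by
      rw [sq, ← det_mul, hTT, populationCov_det hV]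
    have h2 : T.det * (T * (1 - M)).det = 1 := by rw [← det_mul, hTS, det_one]
    have h3 : (T * (1 - M)).det ^ 2 * ∏ j, (1 + h j) = 1 := by
      rw [← h1, ← mul_pow, mul_comm, h2, one_pow]
    have h4 : 0 < ∏ j, (1 + h j) := Finset.prod_pos fun j _ => by linarith [hh j]
    rw [Real.finsetProd_rpow _ _ fun j _ => by linarith [hh j], ← Real.sqrt_sq_eq_abs,
      eq_div_of_mul_eq h4.ne' h3, neg_div, Real.rpow_neg h4.le, ← Real.sqrt_eq_rpow, one_div,
      Real.sqrt_inv]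
  have hn' : ∏ j, (1 + h j) ^ (-(n : ℝ) / 2) = (∏ j, (1 + h j) ^ (-(1 : ℝ) / 2)) ^ n := by
    rw [← Finset.prod_pow]
    refine Finset.prod_congr rfl fun j _ => ?_
    rw [← Real.rpow_natCast, ← Real.rpow_mul (by linarith [hh j])]
    congr 1
    ring
  have hmap := nullLaw_map_act hn hTS
  rw [hSS, sub_sub_cancel, hdet, ← hn'] at hmap
  rw [← hmap]
  have hp : IsProbabilityMeasure ((stdGaussian (EuclideanSpace ℝ (Fin p))).map
    (toEuclideanCLM (𝕜 := ℝ) T)) := Measure.isProbabilityMeasure_map (by fun_prop)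
  have h1 := Measure.pi_map_pi (μ := fun _ : Fin n => stdGaussian (EuclideanSpace ℝ (Fin p)))
    (f := fun _ => toEuclideanCLM (𝕜 := ℝ) T) (fun _ => by fun_prop)
  unfold nullLaw act
  rw [h1, dataLaw]
  simp [multivariateGaussian, hT]

/-- The density of the law of the data under the null hypothesis. -/
theorem nullLaw_eq_withDensity {p n : ℕ} (hn : 1 ≤ n) :
    nullLaw p n = volume.withDensity fun X =>
      ENNReal.ofReal (((√(2 * Real.pi))⁻¹ ^ p) ^ n * Real.exp (-(n / 2 * eigenvalueSum X))) := by
  have h0 := stdGaussian_eq_withDensity p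
  have hsf : SigmaFinite ((volume : Measure (EuclideanSpace ℝ (Fin p))).withDensity fun x =>
      ENNReal.ofReal ((√(2 * Real.pi))⁻¹ ^ p * Real.exp (-‖x‖ ^ 2 / 2))) := by
    rw [← h0]; infer_instance
  unfold nullLaw
  rw [h0, pi_withDensity _ _ fun _ => by fun_prop]
  change volume.withDensity _ = _
  congr 1
  funext X
  rw [← ENNReal.ofReal_prod_of_nonneg fun i _ => by positivity, Finset.prod_mul_distrib,
    ← Real.exp_sum, ← Finset.sum_div, Finset.sum_neg_distrib, sum_norm_sq hn X,
    eigenvalueSum_eq_trace]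
  simp only [Finset.prod_const, Finset.card_univ, Fintype.card_fin]
  congr 3
  ring

/-! ### Averaging over the orthogonal group -/

/-- The extension of a vector of length `r` by zeros to a vector of length `p`. -/
def zeroExtend {r : ℕ} (p : ℕ) (k : Fin r → ℝ) (i : Fin p) : ℝ :=
  if hi : (i : ℕ) < r then k ⟨i, hi⟩ else 0

theorem le_of_transpose_mul_eq_one {p r : ℕ} {V : Matrix (Fin p) (Fin r) ℝ} (hV : Vᵀ * V = 1) :
    r ≤ p := by
  have h1 := rank_mul_le_right Vᵀ V
  rw [hV, rank_one, Fintype.card_fin] at h1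
  exact h1.trans (rank_le_height V)

theorem exists_orthogonal_extension {p r : ℕ} {V : Matrix (Fin p) (Fin r) ℝ}
    (hV : Vᵀ * V = 1) : ∃ W : Orthogonal p, ∀ k : Fin r → ℝ,
      V * diagonal k * Vᵀ = (W : Matrix (Fin p) (Fin p) ℝ) * diagonal (zeroExtend p k) *
        (W : Matrix (Fin p) (Fin p) ℝ)ᵀ := by
  have hr := le_of_transpose_mul_eq_one hV
  set v : Fin p → EuclideanSpace ℝ (Fin p) := fun i =>
    if hi : (i : ℕ) < r then WithLp.toLp 2 fun a => V a ⟨i, hi⟩ else 0 with hv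
  have hon : Orthonormal ℝ ({i : Fin p | (i : ℕ) < r}.domRestrict v) := by
    rw [orthonormal_iff_ite]
    rintro ⟨i, hi⟩ ⟨j, hj⟩
    have h1 := congrFun (congrFun hV ⟨i, hi⟩) ⟨j, hj⟩
    have hi' : (i : ℕ) < r := hi
    have hj' : (j : ℕ) < r := hj
    simp only [Set.domRestrict_apply, hv, hi', hj', dif_pos, PiLp.inner_apply]
    rw [Matrix.mul_apply, one_apply] at h1
    simp only [transpose_apply, Fin.mk.injEq, Fin.val_inj] at h1
    simpa [mul_comm, Subtype.ext_iff] using h1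
  obtain ⟨b, hb⟩ := hon.exists_orthonormalBasis_extension_of_card_eq (by simp)
  have hW : (Matrix.of fun a i => b i a) ∈ Matrix.unitaryGroup (Fin p) ℝ := by
    rw [mem_orthogonal_iff, mul_eq_one_comm]
    ext i j
    have h1 := orthonormal_iff_ite.mp b.orthonormal i j
    rw [PiLp.inner_apply] at h1
    simpa [Matrix.mul_apply, one_apply, mul_comm] using h1
  refine ⟨⟨_, hW⟩, fun k => ?_⟩
  ext a c
  rw [Matrix.mul_apply, Matrix.mul_apply]
  simp only [mul_diagonal, transpose_apply, of_apply]
  refine Fintype.sum_of_injective (Fin.castLE hr) (Fin.castLE_injective hr) _ _ ?_ ?_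
  · intro i hi
    have : ¬ (i : ℕ) < r := fun h => hi ⟨⟨i, h⟩, rfl⟩
    simp [zeroExtend, this]
  · intro j
    have h1 : b (Fin.castLE hr j) = WithLp.toLp 2 fun a => V a j := by
      rw [hb _ (by simp)]
      simp [hv]
    simp [zeroExtend, h1]

theorem spikeMatrix_eq {r : ℕ} (p n : ℕ) (h : Fin r → ℝ) : spikeMatrix p n h =
    (1 / (2 * ((p : ℝ) / (n : ℝ)))) • diagonal (zeroExtend p fun j => h j / (1 + h j)) := by
  rw [spikeMatrix, ← diagonal_smul]
  congr 1
  funext i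
  simp only [Pi.smul_apply, zeroExtend, smul_eq_mul]
  split_ifs <;> simp

theorem sphericalIntegral_spikeMatrix {p n r : ℕ} (hp : 1 ≤ p) (hn : 1 ≤ n)
    {V : Matrix (Fin p) (Fin r) ℝ} (hV : Vᵀ * V = 1) (h : Fin r → ℝ)
    (L : Matrix (Fin p) (Fin p) ℝ) :
    sphericalIntegral p (spikeMatrix p n h) L =
      sphericalIntegral (n / 2) (V * diagonal (fun j => h j / (1 + h j)) * Vᵀ) L := by
  obtain ⟨W, hW⟩ := exists_orthogonal_extension hV
  have : (n : ℝ) ≠ 0 := by positivity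
  have : (p : ℝ) ≠ 0 := by positivity
  rw [hW, sphericalIntegral_conj_left, spikeMatrix_eq, sphericalIntegral_smul_left]
  congr 1
  field_simp

theorem lintegral_dataLaw {p n r : ℕ} (hp : 1 ≤ p) (hn : 1 ≤ n)
    {V : Matrix (Fin p) (Fin r) ℝ} (hV : Vᵀ * V = 1) {h : Fin r → ℝ} (hh : ∀ j, 0 ≤ h j)
    {F : Sample p n → ℝ≥0∞} (hF : Measurable F)
    (hinv : ∀ (Q : Orthogonal p) X, F (act (Q : Matrix (Fin p) (Fin p) ℝ) X) = F X) :
    ∫⁻ X, F X ∂(dataLaw n V h) = ∫⁻ X, F X * ENNReal.ofReal ((∏ j, (1 + h j) ^ (-(n : ℝ) / 2)) *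
      sphericalIntegral p (spikeMatrix p n h) (sampleCov X)) ∂(nullLaw p n) := by
  set c : ℝ := ∏ j, (1 + h j) ^ (-(n : ℝ) / 2) with hc
  have hc0 : 0 ≤ c := Finset.prod_nonneg fun j _ => Real.rpow_nonneg (by linarith [hh j]) _
  set M := V * diagonal (fun j => h j / (1 + h j)) * Vᵀ with hM
  set ρ : Sample p n → ℝ≥0∞ := fun X =>
    ENNReal.ofReal (c * Real.exp (n / 2 * (M * sampleCov X).trace)) with hρ
  have hcov := continuous_sampleCov p n
  have hρm : Measurable ρ := by
    refine ENNReal.measurable_ofReal.comp (Continuous.measurable ?_)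
    fun_prop
  have hQ : ∀ Q : Orthogonal p, ∫⁻ X, F X ∂(dataLaw n V h) = ∫⁻ X, F X * ENNReal.ofReal (c *
      Real.exp (n / 2 * (M * (Q : Matrix (Fin p) (Fin p) ℝ)ᵀ * sampleCov X *
        (Q : Matrix (Fin p) (Fin p) ℝ)).trace)) ∂(nullLaw p n) := by
    intro Q
    rw [dataLaw_eq_withDensity hn hV hh, lintegral_withDensity_eq_lintegral_mul _ hρm hF,
      ← nullLaw_map_act_orthogonal hn Q⁻¹, lintegral_map (hρm.mul hF) (measurable_act _),
      nullLaw_map_act_orthogonal hn Q⁻¹]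
    refine lintegral_congr fun X => ?_
    have hi : ((Q⁻¹ : Orthogonal p) : Matrix (Fin p) (Fin p) ℝ) =
        (Q : Matrix (Fin p) (Fin p) ℝ)ᵀ := by
      rw [UnitaryGroup.inv_val, star_eq_conjTranspose, conjTranspose_eq_transpose_of_trivial]
    simp only [Pi.mul_apply, hρ]
    rw [hinv, mul_comm, hi, sampleCov_act, transpose_transpose]
    simp only [Matrix.mul_assoc]
  have h1 : ∫⁻ X, F X ∂(dataLaw n V h) =
      ∫⁻ _ : Orthogonal p, ∫⁻ X, F X ∂(dataLaw n V h) ∂(orthogonalHaar p) := by simp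
  rw [h1, lintegral_congr hQ, lintegral_lintegral_swap]
  · refine lintegral_congr fun X => ?_
    rw [lintegral_const_mul _ (by
      refine ENNReal.measurable_ofReal.comp (Continuous.measurable ?_)
      fun_prop)]
    congr 1
    rw [sphericalIntegral_spikeMatrix hp hn hV, ENNReal.ofReal_mul hc0, ofReal_sphericalIntegral,
      ← lintegral_const_mul _ (by
      refine ENNReal.measurable_ofReal.comp (Continuous.measurable ?_)
      fun_prop)]
    exact lintegral_congr fun Q => ENNReal.ofReal_mul hc0
  · refine ((hF.comp measurable_snd).mul
      (ENNReal.measurable_ofReal.comp (Continuous.measurable ?_))).aemeasurable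
    fun_prop

/-! ### The eigenvalue laws under an alternative, relative to the null hypothesis -/

theorem sampleEigenvalues_act {p n : ℕ} (Q : Orthogonal p) (X : Sample p n) :
    sampleEigenvalues (act (Q : Matrix (Fin p) (Fin p) ℝ) X) = sampleEigenvalues X :=
  sampleEigenvalues_eq_of_conj Q (sampleCov_act _ X)

theorem lambdaVec_act {p n : ℕ} (Q : Orthogonal p) (X : Sample p n) :
    lambdaVec (act (Q : Matrix (Fin p) (Fin p) ℝ) X) = lambdaVec X := by
  funext i
  simp only [lambdaVec, sampleEigenvalues_act]

theorem muVec_act {p n : ℕ} (Q : Orthogonal p) (X : Sample p n) :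
    muVec (act (Q : Matrix (Fin p) (Fin p) ℝ) X) = muVec X := by
  funext i
  simp only [muVec, eigenvalueSum, sampleEigenvalues_act]

theorem eigenvalueSum_smul {p n : ℕ} (t : ℝ) (X : Sample p n) :
    eigenvalueSum (t • X) = t ^ 2 * eigenvalueSum X := by
  simp only [eigenvalueSum, sampleEigenvalues_smul, Pi.smul_apply, smul_eq_mul, Finset.mul_sum]

theorem muVec_smul {p n : ℕ} {t : ℝ} (ht : t ≠ 0) (X : Sample p n) :
    muVec (t • X) = muVec X := by
  funext i
  simp only [muVec, eigenvalueSum_smul, sampleEigenvalues_smul, Pi.smul_apply, smul_eq_mul]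
  exact mul_div_mul_left _ _ (pow_ne_zero 2 ht)

theorem zeroExtend_lambdaVec {p n : ℕ} (X : Sample p n) :
    zeroExtend p (lambdaVec X) = sampleEigenvalues X := by
  funext i
  rw [zeroExtend]
  split_ifs with hi
  · rfl
  · exact (sampleEigenvalues_eq_zero X i (by have := i.2; omega)).symm

theorem continuous_zeroExtend (r p : ℕ) :
    Continuous (zeroExtend p : (Fin r → ℝ) → Fin p → ℝ) := by
  refine continuous_pi fun i => ?_
  unfold zeroExtend
  split_ifs <;> fun_prop

/-- The density of the law of `λ_p` with respect to its law under the null hypothesis. -/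
noncomputable def lambdaRelDensity {r : ℕ} (p n : ℕ) (h : Fin r → ℝ)
    (x : Fin (min p n) → ℝ) : ℝ≥0∞ :=
  ENNReal.ofReal ((∏ j, (1 + h j) ^ (-(n : ℝ) / 2)) *
    sphericalIntegral p (spikeMatrix p n h) (diagonal (zeroExtend p x)))

theorem measurable_lambdaRelDensity {r : ℕ} (p n : ℕ) (h : Fin r → ℝ) :
    Measurable (lambdaRelDensity p n h) := by
  refine ENNReal.measurable_ofReal.comp (Continuous.measurable ?_)
  have h1 := (continuous_sphericalIntegral (spikeMatrix p n h)).comp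
    ((continuous_const (y := (p : ℝ))).prodMk (continuous_zeroExtend (min p n) p).matrix_diagonal)
  exact continuous_const.mul h1

theorem lambdaRelDensity_lambdaVec {p n r : ℕ} (h : Fin r → ℝ) (X : Sample p n) :
    lambdaRelDensity p n h (lambdaVec X) = ENNReal.ofReal ((∏ j, (1 + h j) ^ (-(n : ℝ) / 2)) *
      sphericalIntegral p (spikeMatrix p n h) (eigenvalueMatrix X)) := by
  rw [lambdaRelDensity, zeroExtend_lambdaVec, eigenvalueMatrix]

theorem lambdaLaw_eq_withDensity {p n r : ℕ} (hp : 1 ≤ p) (hn : 1 ≤ n)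
    {V : Matrix (Fin p) (Fin r) ℝ} (hV : Vᵀ * V = 1) {h : Fin r → ℝ} (hh : ∀ j, 0 ≤ h j) :
    lambdaLaw n V h = (lambdaLaw n V 0).withDensity (lambdaRelDensity p n h) := by
  have hm := measurable_lambdaVec p n
  ext s hs
  rw [withDensity_apply _ hs, lambdaLaw, lambdaLaw, Measure.map_apply hm hs,
    setLIntegral_map hs (measurable_lambdaRelDensity p n h) hm, dataLaw_zero,
    ← lintegral_indicator_one (hm hs), lintegral_dataLaw hp hn hV hh
      (measurable_one.indicator (hm hs)), ← lintegral_indicator (hm hs)]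
  · refine lintegral_congr fun X => ?_
    by_cases hX : X ∈ lambdaVec ⁻¹' s
    · simp only [indicator_of_mem hX, Pi.one_apply, one_mul, lambdaRelDensity_lambdaVec,
        sphericalIntegral_eigenvalueMatrix]
    · simp only [indicator_of_notMem hX, zero_mul]
  · intro Q X
    exact congrArg (s.indicator 1) (lambdaVec_act Q X)

theorem setLIntegral_gammaPDFReal {a b : ℝ} (ha : 0 < a) (hb : 0 < b) :
    ∫⁻ x in Ioi 0, ENNReal.ofReal (gammaPDFReal a b x) = 1 := by
  rw [← lintegral_gammaPDF_eq_one ha hb, ← lintegral_indicator measurableSet_Ioi]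
  refine lintegral_congr_ae ?_
  filter_upwards [Measure.ae_ne volume (0 : ℝ)] with x hx
  rcases lt_or_gt_of_ne hx with hx | hx
  · rw [indicator_of_notMem (by simpa using hx.le), gammaPDF_of_neg hx]
  · rw [indicator_of_mem (mem_Ioi.mpr hx), gammaPDF]

theorem setLIntegral_gammaPDFReal_comp_sqrt {d : ℕ} (hd : 1 ≤ d) {b s : ℝ} (hb : 0 < b)
    (hs : 0 < s) (g : ℝ → ℝ≥0∞) :
    ∫⁻ x in Ioi 0, ENNReal.ofReal (gammaPDFReal (d / 2) b x) * g √(x / s) =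
      ENNReal.ofReal (2 * (b ^ ((d : ℝ) / 2) / Real.Gamma (d / 2)) * s ^ ((d : ℝ) / 2)) *
        ∫⁻ r in Ioi 0, ENNReal.ofReal (r ^ (d - 1) * Real.exp (-(b * (r ^ 2 * s)))) * g r := by
  have himg : (fun r : ℝ => s * r ^ 2) '' Ioi 0 = Ioi 0 := by
    ext x
    constructor
    · rintro ⟨r, hr, rfl⟩
      have : (0 : ℝ) < r := hr
      exact mem_Ioi.mpr (by positivity)
    · intro hx
      have hx' : (0 : ℝ) < x := hx
      refine ⟨√(x / s), Real.sqrt_pos.mpr (by positivity), ?_⟩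
      simp only
      rw [Real.sq_sqrt (by positivity)]
      field_simp
  have hinj : InjOn (fun r : ℝ => s * r ^ 2) (Ioi 0) := by
    intro r hr r' hr' h
    have h1 : r ^ 2 = r' ^ 2 := mul_left_cancel₀ hs.ne' h
    exact (pow_left_inj₀ (le_of_lt hr) (le_of_lt hr') two_ne_zero).mp h1
  have hcv := lintegral_image_eq_lintegral_abs_deriv_mul measurableSet_Ioi
    (f := fun r : ℝ => s * r ^ 2) (f' := fun r => s * (2 * r))
    (fun r _ => by simpa using ((hasDerivAt_pow 2 r).const_mul s).hasDerivWithinAt) hinj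
    (fun x => ENNReal.ofReal (gammaPDFReal (d / 2) b x) * g √(x / s))
  rw [himg] at hcv
  have hc : 0 ≤ 2 * (b ^ ((d : ℝ) / 2) / Real.Gamma (d / 2)) * s ^ ((d : ℝ) / 2) := by
    have : 0 < Real.Gamma ((d : ℝ) / 2) := Real.Gamma_pos_of_pos (by positivity)
    positivity
  rw [hcv, ← lintegral_const_mul' _ _ ENNReal.ofReal_ne_top]
  refine setLIntegral_congr_fun measurableSet_Ioi fun r hr => ?_
  have hr' : (0 : ℝ) < r := hr
  have h1 : √(s * r ^ 2 / s) = r := by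
    rw [mul_div_cancel_left₀ _ hs.ne', Real.sqrt_sq hr'.le]
  simp only [h1]
  rw [← mul_assoc, ← mul_assoc (ENNReal.ofReal (2 * _ * _)), ← ENNReal.ofReal_mul (abs_nonneg _), ← ENNReal.ofReal_mul hc,
    abs_of_nonneg (by positivity), gammaPDFReal, if_pos (by positivity)]
  congr 2
  have h2 : (s * r ^ 2) ^ ((d : ℝ) / 2 - 1) * (s * r) = s ^ ((d : ℝ) / 2) * r ^ (d - 1) := by
    rw [Real.mul_rpow hs.le (by positivity), ← Real.rpow_natCast r 2, ← Real.rpow_mul hr'.le,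
      ← Real.rpow_natCast r (d - 1), Nat.cast_sub hd]
    calc _ = (s ^ ((d : ℝ) / 2 - 1) * s) * (r ^ (((2 : ℕ) : ℝ) * ((d : ℝ) / 2 - 1)) * r) := by ring
      _ = _ := by
        rw [← Real.rpow_add_one hs.ne', ← Real.rpow_add_one hr'.ne']
        congr 2
        · ring
        · push_cast; ring
  calc _ = 2 * (b ^ ((d : ℝ) / 2) / Real.Gamma (d / 2)) *
        ((s * r ^ 2) ^ ((d : ℝ) / 2 - 1) * (s * r)) * Real.exp (-(b * (s * r ^ 2))) := by ring
    _ = _ := by rw [h2, mul_comm s (r ^ 2)]; ring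

theorem finrank_sample (p n : ℕ) : Module.finrank ℝ (Sample p n) = n * p := by
  simp [Sample, Module.finrank_pi_fintype]

theorem nontrivial_sample {p n : ℕ} (hp : 1 ≤ p) (hn : 1 ≤ n) : Nontrivial (Sample p n) := by
  have : Nonempty (Fin n) := ⟨⟨0, hn⟩⟩
  have : Nonempty (Fin p) := ⟨⟨0, hp⟩⟩
  exact inferInstanceAs (Nontrivial (Fin n → EuclideanSpace ℝ (Fin p)))

theorem nullLaw_absolutelyContinuous {p n : ℕ} (hn : 1 ≤ n) : nullLaw p n ≪ volume := by
  rw [nullLaw_eq_withDensity hn]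
  exact withDensity_absolutelyContinuous _ _

/-- Under the null hypothesis, the radial part of the data is independent of its direction and
`S_p` has a Gamma distribution. -/
theorem lintegral_nullLaw_radial {p n : ℕ} (hp : 1 ≤ p) (hn : 1 ≤ n) {F G : Sample p n → ℝ≥0∞}
    (hF : Measurable F) (hG : Measurable G) (hFs : ∀ t : ℝ, 0 < t → ∀ X, F (t • X) = F X) :
    ∫⁻ X, F X * G X ∂(nullLaw p n) = ∫⁻ X, F X * (∫⁻ x in Ioi (0 : ℝ),
      ENNReal.ofReal (gammaPDFReal ((n : ℝ) * p / 2) (n / 2) x) *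
        G (√(x / eigenvalueSum X) • X)) ∂(nullLaw p n) := by
  have := nontrivial_sample hp hn
  have hn0 : (0 : ℝ) < n := by exact_mod_cast hn
  have hp0 : (0 : ℝ) < p := by exact_mod_cast hp
  have hd : 1 ≤ n * p := Nat.mul_pos hn hp
  have hS := measurable_eigenvalueSum p n
  set κ : ℝ := ((√(2 * Real.pi))⁻¹ ^ p) ^ n with hκ
  have hκ0 : 0 ≤ κ := by positivity
  set φ : Sample p n → ℝ≥0∞ :=
    fun X => ENNReal.ofReal (κ * Real.exp (-(n / 2 * eigenvalueSum X))) with hφ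
  have hφm : Measurable φ := by fun_prop
  set I : Sample p n → ℝ≥0∞ := fun X => ∫⁻ x in Ioi (0 : ℝ),
      ENNReal.ofReal (gammaPDFReal ((n : ℝ) * p / 2) (n / 2) x) *
        G (√(x / eigenvalueSum X) • X) with hI
  have hIm : Measurable I := by
    have h1 : Measurable fun q : Sample p n × ℝ =>
        ENNReal.ofReal (gammaPDFReal ((n : ℝ) * p / 2) (n / 2) q.2) *
          G (√(q.2 / eigenvalueSum q.1) • q.1) := by
      have h2 := measurable_gammaPDFReal ((n : ℝ) * p / 2) (n / 2)
      have h3 : Measurable fun q : Sample p n × ℝ => √(q.2 / eigenvalueSum q.1) :=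
        (measurable_snd.div (hS.comp measurable_fst)).sqrt
      exact (ENNReal.measurable_ofReal.comp (h2.comp measurable_snd)).mul
        (hG.comp (h3.smul measurable_fst))
    exact h1.lintegral_prod_right'
  have hIs : ∀ t : ℝ, 0 < t → ∀ X, I (t • X) = I X := by
    intro t ht X
    refine lintegral_congr fun x => ?_
    rw [eigenvalueSum_smul, smul_smul]
    congr 3
    rw [← div_div, div_right_comm, Real.sqrt_div' _ (sq_nonneg t), Real.sqrt_sq ht.le]
    field_simp
  have key : ∀ H : Sample p n → ℝ≥0∞, Measurable H →
      ∫⁻ X, F X * H X ∂(nullLaw p n) = ∫⁻ w : Metric.sphere (0 : Sample p n) 1,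
        F w * (ENNReal.ofReal κ * ∫⁻ r in Ioi (0 : ℝ), ENNReal.ofReal (r ^ (n * p - 1) *
          Real.exp (-(n / 2 * (r ^ 2 * eigenvalueSum (w : Sample p n))))) * H (r • (w : Sample p n)))
          ∂(volume : Measure (Sample p n)).toSphere := by
    intro H hH
    rw [nullLaw_eq_withDensity hn]
    change ∫⁻ X, (F * H) X ∂(volume.withDensity φ) = _
    rw [lintegral_withDensity_eq_lintegral_mul _ hφm (hF.mul hH),
      lintegral_polar _ _ (hφm.mul (hF.mul hH)), finrank_sample]
    refine lintegral_congr fun w => ?_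
    have hHw : Measurable fun r : ℝ => H (r • (w : Sample p n)) := hH.comp (by fun_prop)
    rw [← lintegral_const_mul _ (by fun_prop), ← lintegral_const_mul _ (by fun_prop)]
    refine setLIntegral_congr_fun measurableSet_Ioi fun r hr => ?_
    have hr' : (0 : ℝ) < r := hr
    simp only [Pi.mul_apply, hφ, hFs r hr', eigenvalueSum_smul]
    rw [ENNReal.ofReal_mul hκ0, ENNReal.ofReal_mul (by positivity)]
    ring
  rw [key G hG, key I hIm]
  refine lintegral_congr fun w => ?_
  have hw : (w : Sample p n) ≠ 0 := ne_zero_of_mem_unit_sphere w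
  have hs := eigenvalueSum_pos hn hw
  have hcast : ((n * p : ℕ) : ℝ) / 2 = (n : ℝ) * p / 2 := by push_cast; rfl
  have h1 := setLIntegral_gammaPDFReal_comp_sqrt hd (half_pos hn0) hs
    fun r => G (r • (w : Sample p n))
  have h2 := setLIntegral_gammaPDFReal_comp_sqrt hd (half_pos hn0) hs fun _ => 1
  simp only [mul_one] at h2
  rw [hcast] at h1 h2
  rw [setLIntegral_gammaPDFReal (by positivity) (by positivity)] at h2
  have h3 : ∫⁻ r in Ioi (0 : ℝ), ENNReal.ofReal (r ^ (n * p - 1) *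
      Real.exp (-(n / 2 * (r ^ 2 * eigenvalueSum (w : Sample p n))))) * I (r • (w : Sample p n)) =
      (∫⁻ r in Ioi (0 : ℝ), ENNReal.ofReal (r ^ (n * p - 1) *
      Real.exp (-(n / 2 * (r ^ 2 * eigenvalueSum (w : Sample p n)))))) * I w := by
    rw [← lintegral_mul_const _ (by fun_prop)]
    refine setLIntegral_congr_fun measurableSet_Ioi fun r hr => ?_
    simp only [hIs r hr]
  rw [h3, hI]
  simp only
  rw [h1, ← mul_assoc (lintegral _ _), mul_comm (lintegral _ _) (ENNReal.ofReal _), ← h2, one_mul]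

/-- The vector of all ratios `λ_{pi} / S_p` in terms of `μ_p`, for `m = min (p, n)`. -/
def muExtend {k : ℕ} (p : ℕ) (y : Fin k → ℝ) (i : Fin p) : ℝ :=
  if hi : (i : ℕ) < k then y ⟨i, hi⟩ else if (i : ℕ) = k then 1 - ∑ j, y j else 0

theorem continuous_muExtend (k p : ℕ) : Continuous (muExtend p : (Fin k → ℝ) → Fin p → ℝ) := by
  refine continuous_pi fun i => ?_
  unfold muExtend
  split_ifs <;> fun_prop

theorem muExtend_muVec {p n : ℕ} (hp : 1 ≤ p) (hn : 1 ≤ n) {X : Sample p n} (hX : X ≠ 0) :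
    diagonal (muExtend p (muVec X)) = (eigenvalueSum X)⁻¹ • eigenvalueMatrix X := by
  have hS := (eigenvalueSum_pos hn hX).ne'
  have hm : 1 ≤ min p n := le_min hp hn
  rw [eigenvalueMatrix, ← diagonal_smul]
  congr 1
  funext i
  rw [Pi.smul_apply, smul_eq_mul, muExtend]
  set l : ℕ → ℝ := fun i => if hi : i < p then sampleEigenvalues X ⟨i, hi⟩ else 0 with hl
  have hl0 : ∀ i, min p n ≤ i → l i = 0 := by
    intro i hi
    simp only [hl]
    split_ifs with h
    · exact sampleEigenvalues_eq_zero X _ (by simp only; omega)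
    · rfl
  have hsum : eigenvalueSum X = ∑ i ∈ Finset.range (min p n - 1), l i + l (min p n - 1) := by
    rw [← Finset.sum_range_succ, Nat.sub_add_cancel hm]
    have h1 : eigenvalueSum X = ∑ i ∈ Finset.range p, l i := by
      rw [← Fin.sum_univ_eq_sum_range]
      simp [eigenvalueSum, hl]
    rw [h1]
    refine (Finset.sum_subset (Finset.range_mono (min_le_left p n)) fun i _ hi => hl0 i ?_).symm
    rw [Finset.mem_range] at hi
    omega
  have hmu : ∑ j, muVec X j = (∑ i ∈ Finset.range (min p n - 1), l i) / eigenvalueSum X := by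
    rw [← Fin.sum_univ_eq_sum_range, Finset.sum_div]
    refine Finset.sum_congr rfl fun j _ => ?_
    have : (j : ℕ) < p := by have := j.2; omega
    simp only [muVec, hl, this, dif_pos]
    rfl
  have hli : sampleEigenvalues X i = l i := by simp [hl]
  split_ifs with h1 h2
  · rw [muVec, mul_comm]
    rfl
  · rw [hmu, hli, h2]
    field_simp
    linarith
  · rw [hli, hl0 i (by omega), mul_zero]

/-- The density of the law of `μ_p` with respect to its law under the null hypothesis. -/
noncomputable def muRelDensity {r : ℕ} (p n : ℕ) (h : Fin r → ℝ)
    (y : Fin (min p n - 1) → ℝ) : ℝ≥0∞ :=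
  ∫⁻ x in Ioi (0 : ℝ), ENNReal.ofReal (gammaPDFReal ((n : ℝ) * p / 2) (n / 2) x) *
    ENNReal.ofReal ((∏ j, (1 + h j) ^ (-(n : ℝ) / 2)) *
      sphericalIntegral (p * x) (spikeMatrix p n h) (diagonal (muExtend p y)))

theorem measurable_muRelDensity {r : ℕ} (p n : ℕ) (h : Fin r → ℝ) :
    Measurable (muRelDensity p n h) := by
  have h1 : Measurable fun q : (Fin (min p n - 1) → ℝ) × ℝ =>
      ENNReal.ofReal (gammaPDFReal ((n : ℝ) * p / 2) (n / 2) q.2) *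
        ENNReal.ofReal ((∏ j, (1 + h j) ^ (-(n : ℝ) / 2)) *
        sphericalIntegral (p * q.2) (spikeMatrix p n h) (diagonal (muExtend p q.1))) := by
    have h2 := measurable_gammaPDFReal ((n : ℝ) * p / 2) (n / 2)
    have h4 := continuous_muExtend (min p n - 1) p
    have h3 : Continuous fun q : (Fin (min p n - 1) → ℝ) × ℝ =>
        sphericalIntegral (p * q.2) (spikeMatrix p n h) (diagonal (muExtend p q.1)) :=
      (continuous_sphericalIntegral (spikeMatrix p n h)).comp
        (f := fun q : (Fin (min p n - 1) → ℝ) × ℝ =>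
          ((p : ℝ) * q.2, diagonal (muExtend p q.1))) (by fun_prop)
    exact (ENNReal.measurable_ofReal.comp (h2.comp measurable_snd)).mul
      (ENNReal.measurable_ofReal.comp (continuous_const.mul h3).measurable)
  exact h1.lintegral_prod_right'

theorem muRelDensity_muVec {p n r : ℕ} (hp : 1 ≤ p) (hn : 1 ≤ n) (h : Fin r → ℝ)
    {X : Sample p n} (hX : X ≠ 0) : muRelDensity p n h (muVec X) =
    ∫⁻ x in Ioi (0 : ℝ), ENNReal.ofReal (gammaPDFReal ((n : ℝ) * p / 2) (n / 2) x) *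
      ENNReal.ofReal ((∏ j, (1 + h j) ^ (-(n : ℝ) / 2)) *
        sphericalIntegral (p * (x / eigenvalueSum X)) (spikeMatrix p n h)
          (eigenvalueMatrix X)) := by
  refine lintegral_congr fun x => ?_
  rw [muExtend_muVec hp hn hX, sphericalIntegral_smul_right, mul_assoc (p : ℝ) x, ← div_eq_mul_inv]

theorem nullLaw_ne_zero {p n : ℕ} (hp : 1 ≤ p) (hn : 1 ≤ n) : ∀ᵐ X ∂(nullLaw p n), X ≠ 0 := by
  have : Nonempty (Fin n) := ⟨⟨0, hn⟩⟩
  have : Nonempty (Fin p) := ⟨⟨0, hp⟩⟩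
  have : Nontrivial (EuclideanSpace ℝ (Fin p)) := inferInstance
  have : NullSingletonClass (volume : Measure (EuclideanSpace ℝ (Fin p))) := inferInstance
  have : NullSingletonClass (volume : Measure (Sample p n)) :=
    inferInstanceAs (NullSingletonClass (volume : Measure (Fin n → EuclideanSpace ℝ (Fin p))))
  exact (nullLaw_absolutelyContinuous hn).ae_le (Measure.ae_ne volume 0)

theorem muLaw_eq_withDensity {p n r : ℕ} (hp : 1 ≤ p) (hn : 1 ≤ n)
    {V : Matrix (Fin p) (Fin r) ℝ} (hV : Vᵀ * V = 1) {h : Fin r → ℝ} (hh : ∀ j, 0 ≤ h j) :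
    muLaw n V h = (muLaw n V 0).withDensity (muRelDensity p n h) := by
  have hm := measurable_muVec p n
  ext s hs
  rw [withDensity_apply _ hs, muLaw, muLaw, Measure.map_apply hm hs,
    setLIntegral_map hs (measurable_muRelDensity p n h) hm, dataLaw_zero,
    ← lintegral_indicator_one (hm hs), lintegral_dataLaw hp hn hV hh
      (measurable_one.indicator (hm hs)), ← lintegral_indicator (hm hs),
      lintegral_nullLaw_radial hp hn (measurable_one.indicator (hm hs))]
  · refine lintegral_congr_ae ?_
    filter_upwards [nullLaw_ne_zero hp hn] with X hX0
    by_cases hX : X ∈ muVec ⁻¹' s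
    · simp only [indicator_of_mem hX, Pi.one_apply, one_mul]
      rw [muRelDensity_muVec hp hn h hX0]
      refine setLIntegral_congr_fun measurableSet_Ioi fun x hx => ?_
      have hx' : (0 : ℝ) < x := hx
      rw [sampleCov_smul, sphericalIntegral_smul_right, sphericalIntegral_eigenvalueMatrix,
        Real.sq_sqrt (div_pos hx' (eigenvalueSum_pos hn hX0)).le]
    · simp only [indicator_of_notMem hX, zero_mul]
  · have h1 := (continuous_sphericalIntegral (spikeMatrix p n h)).comp
      ((continuous_const (y := (p : ℝ))).prodMk (continuous_sampleCov p n))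
    exact ENNReal.measurable_ofReal.comp (continuous_const.mul h1).measurable
  · intro t ht X
    exact congrArg (s.indicator 1) (muVec_smul ht.ne' X)
  · intro Q X
    exact congrArg (s.indicator 1) (muVec_act Q X)

/-! ### Absolute continuity -/

/-- The first `k` power sums. -/
def powerSum {k : ℕ} (x : Fin k → ℝ) (j : Fin k) : ℝ := ∑ i, x i ^ ((j : ℕ) + 1)

theorem differentiable_powerSum (k : ℕ) : Differentiable ℝ (powerSum (k := k)) := by
  unfold powerSum
  fun_prop

theorem trace_diagonal_pow {p : ℕ} (d : Fin p → ℝ) (k : ℕ) :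
    (diagonal d ^ k).trace = ∑ i, d i ^ k := by
  rw [diagonal_pow, trace_diagonal]
  rfl

theorem trace_conj_pow {p : ℕ} (U : Orthogonal p) (A : Matrix (Fin p) (Fin p) ℝ) (k : ℕ) :
    (((U : Matrix (Fin p) (Fin p) ℝ) * A * (U : Matrix (Fin p) (Fin p) ℝ)ᵀ) ^ k).trace =
      (A ^ k).trace := by
  have h : ((U : Matrix (Fin p) (Fin p) ℝ) * A * (U : Matrix (Fin p) (Fin p) ℝ)ᵀ) ^ k =
      (U : Matrix (Fin p) (Fin p) ℝ) * A ^ k * (U : Matrix (Fin p) (Fin p) ℝ)ᵀ := by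
    induction k with
    | zero => simp [U.mul_transpose]
    | succ k ih =>
      rw [pow_succ, ih, pow_succ]
      calc _ = (U : Matrix (Fin p) (Fin p) ℝ) * A ^ k * ((U : Matrix (Fin p) (Fin p) ℝ)ᵀ *
            (U : Matrix (Fin p) (Fin p) ℝ)) * A * (U : Matrix (Fin p) (Fin p) ℝ)ᵀ := by
            simp only [Matrix.mul_assoc]
        _ = _ := by rw [U.transpose_mul, Matrix.mul_one]; simp only [Matrix.mul_assoc]
  rw [h, Matrix.trace_mul_comm, ← Matrix.mul_assoc, U.transpose_mul, Matrix.one_mul]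

theorem sum_zeroExtend_pow {p r : ℕ} (hr : r ≤ p) (d : Fin r → ℝ) (k : ℕ) :
    ∑ i, zeroExtend p d i ^ (k + 1) = ∑ i, d i ^ (k + 1) := by
  refine (Fintype.sum_of_injective (Fin.castLE hr) (Fin.castLE_injective hr) _ _ ?_ ?_).symm
  · intro i hi
    have : ¬ (i : ℕ) < r := fun h => hi ⟨⟨i, h⟩, rfl⟩
    simp [zeroExtend, this]
  · intro j
    simp [zeroExtend]

/-- The traces of the first powers of the sample covariance matrix. -/
noncomputable def tracePowers (p n : ℕ) (X : Sample p n) (k : Fin (min p n)) : ℝ :=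
  (sampleCov X ^ ((k : ℕ) + 1)).trace

theorem tracePowers_eq {p n : ℕ} (X : Sample p n) :
    tracePowers p n X = powerSum (lambdaVec X) := by
  funext k
  obtain ⟨U, hU⟩ := exists_sampleCov_eq X
  rw [tracePowers, hU, trace_conj_pow, eigenvalueMatrix, trace_diagonal_pow,
    ← zeroExtend_lambdaVec, sum_zeroExtend_pow (min_le_left p n), powerSum]

theorem analyticAt_pow_apply {E : Type*} [NormedAddCommGroup E] [NormedSpace ℝ E] {p : ℕ}
    {A : E → Matrix (Fin p) (Fin p) ℝ} {x : E} (hA : ∀ i j, AnalyticAt ℝ (fun y => A y i j) x)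
    (k : ℕ) : ∀ i j, AnalyticAt ℝ (fun y => (A y ^ k) i j) x := by
  induction k with
  | zero => intro i j; simpa using analyticAt_const
  | succ k ih =>
    intro i j
    simp only [pow_succ, Matrix.mul_apply]
    exact Finset.analyticAt_fun_sum _ fun l _ => (ih i l).fun_mul (hA l j)

theorem analyticOnNhd_tracePowers (p n : ℕ) : AnalyticOnNhd ℝ (tracePowers p n) univ := by
  intro X _
  refine AnalyticAt.pi fun k => ?_
  have hc : ∀ t i, AnalyticAt ℝ (fun X : Sample p n => X t i) X := fun t i =>
    ((EuclideanSpace.proj i).comp (ContinuousLinearMap.proj (R := ℝ)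
      (φ := fun _ : Fin n => EuclideanSpace ℝ (Fin p)) t)).analyticAt X
  have hcov : ∀ i j, AnalyticAt ℝ (fun X : Sample p n => sampleCov X i j) X := by
    intro i j
    simp only [sampleCov, Matrix.smul_apply, Matrix.mul_apply, transpose_apply, dataMatrix,
      of_apply, smul_eq_mul]
    exact analyticAt_const.fun_mul
      (Finset.analyticAt_fun_sum _ fun t _ => (hc t i).fun_mul (hc t j))
  simp only [tracePowers, Matrix.trace, diag_apply]
  exact Finset.analyticAt_fun_sum _ fun i _ => analyticAt_pow_apply hcov _ i i

/-- The samples with a diagonal data matrix. -/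
noncomputable def diagonalSample (p n : ℕ) : (Fin (min p n) → ℝ) →L[ℝ] Sample p n :=
  LinearMap.toContinuousLinearMap
    { toFun := fun v t => WithLp.toLp 2 fun i => if (i : ℕ) = t then zeroExtend p v i else 0
      map_add' := by
        intro v w
        ext t i
        simp only [zeroExtend, Pi.add_apply, PiLp.add_apply]
        split_ifs <;> simp
      map_smul' := by
        intro c v
        ext t i
        simp only [zeroExtend, Pi.smul_apply, PiLp.smul_apply, RingHom.id_apply, smul_eq_mul]
        split_ifs <;> simp }

theorem sampleCov_diagonalSample {p n : ℕ} (v : Fin (min p n) → ℝ) :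
    sampleCov (diagonalSample p n v) = diagonal (zeroExtend p fun i => 1 / (n : ℝ) * v i ^ 2) := by
  have hX : dataMatrix (diagonalSample p n v) =
      of fun (i : Fin p) (t : Fin n) => if (i : ℕ) = t then zeroExtend p v i else 0 := rfl
  ext i j
  rw [sampleCov, hX, Matrix.smul_apply, Matrix.mul_apply]
  simp only [transpose_apply, of_apply, smul_eq_mul]
  by_cases hij : i = j
  · subst hij
    rw [diagonal_apply_eq]
    by_cases hi : (i : ℕ) < n
    · rw [Finset.sum_eq_single ⟨i, hi⟩]
      · have : (i : ℕ) < min p n := lt_min i.2 hi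
        simp only [if_true, zeroExtend, this, dif_pos]
        ring
      · intro t _ ht
        have : (i : ℕ) ≠ t := fun h => ht (Fin.ext h.symm)
        simp [this]
      · simp
    · have : ¬ (i : ℕ) < min p n := fun h => hi (lt_min_iff.mp h).2
      simp [zeroExtend, this]
  · rw [diagonal_apply_ne _ hij, Finset.sum_eq_zero, mul_zero]
    intro t _
    by_cases hi : (i : ℕ) = t
    · have : (j : ℕ) ≠ t := fun h => hij (Fin.ext (hi.trans h.symm))
      simp [this]
    · simp [hi]

theorem tracePowers_diagonalSample {p n : ℕ} (v : Fin (min p n) → ℝ) :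
    tracePowers p n (diagonalSample p n v) = fun k : Fin (min p n) =>
      ∑ i, (1 / (n : ℝ) * v i ^ 2) ^ ((k : ℕ) + 1) := by
  funext k
  rw [tracePowers, sampleCov_diagonalSample, trace_diagonal_pow,
    sum_zeroExtend_pow (min_le_left p n)]

theorem exists_fderiv_tracePowers_det_ne_zero {p n : ℕ} (hn : 1 ≤ n) : ∃ X : Sample p n,
    ((fderiv ℝ (tracePowers p n) X).comp (diagonalSample p n)).det ≠ 0 := by
  set m := min p n
  have hn0 : (0 : ℝ) < n := by exact_mod_cast hn
  set v : Fin m → ℝ := fun i => (i : ℝ) + 1 with hv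
  set c : Matrix (Fin m) (Fin m) ℝ := diagonal (fun k : Fin m => ((k : ℕ) : ℝ) + 1) *
    (vandermonde fun i => 1 / (n : ℝ) * v i ^ 2)ᵀ * diagonal (fun i => 1 / (n : ℝ) * (2 * v i))
    with hc
  refine ⟨diagonalSample p n v, ?_⟩
  have h1 : HasFDerivAt (fun v => tracePowers p n (diagonalSample p n v))
      ((fderiv ℝ (tracePowers p n) (diagonalSample p n v)).comp (diagonalSample p n)) v :=
    ((analyticOnNhd_tracePowers p n _ (mem_univ _)).differentiableAt.hasFDerivAt).comp v
      (diagonalSample p n).hasFDerivAt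
  have h2 : HasFDerivAt (fun v => tracePowers p n (diagonalSample p n v))
      (LinearMap.toContinuousLinearMap (Matrix.toLin' c)) v := by
    simp_rw [tracePowers_diagonalSample]
    rw [hasFDerivAt_pi']
    intro k
    have hs : HasFDerivAt (fun v : Fin m → ℝ => ∑ i, (1 / (n : ℝ) * v i ^ 2) ^ ((k : ℕ) + 1))
        (∑ i, c k i • ContinuousLinearMap.proj (R := ℝ) (φ := fun _ : Fin m => ℝ) i) v := by
      refine HasFDerivAt.fun_sum fun i _ => ?_
      have hd : HasDerivAt (fun x : ℝ => (1 / (n : ℝ) * x ^ 2) ^ ((k : ℕ) + 1)) (c k i) (v i) := by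
        refine (((hasDerivAt_pow 2 (v i)).const_mul (1 / (n : ℝ))).pow
          ((k : ℕ) + 1)).congr_deriv ?_
        rw [hc, mul_diagonal, diagonal_mul, transpose_apply, vandermonde_apply]
        push_cast
        simp
      have hp := (ContinuousLinearMap.proj (R := ℝ) (φ := fun _ : Fin m => ℝ) i).hasFDerivAt
        (x := v)
      exact hd.comp_hasFDerivAt v hp
    refine hs.congr_fderiv ?_
    ext w
    simp [Matrix.mulVec, dotProduct]
    rfl
  rw [h1.unique h2, ContinuousLinearMap.det, LinearMap.coe_toContinuousLinearMap,
    LinearMap.det_toLin', hc, det_mul, det_mul, det_diagonal, det_diagonal, det_transpose]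
  refine mul_ne_zero (mul_ne_zero ?_ ?_) ?_
  · exact Finset.prod_ne_zero_iff.mpr fun k _ => by positivity
  · rw [det_vandermonde_ne_zero_iff]
    intro i j hij
    have h3 : v i ^ 2 = v j ^ 2 := mul_left_cancel₀ (by positivity) hij
    have h4 := (pow_left_inj₀ (by positivity) (by positivity) two_ne_zero).mp h3
    simpa [hv, Fin.val_inj] using h4
  · exact Finset.prod_ne_zero_iff.mpr fun k _ => by positivity

theorem nullLaw_lambdaVec_preimage {p n : ℕ} (hp : 1 ≤ p) (hn : 1 ≤ n)
    {N : Set (Fin (min p n) → ℝ)} (hN : volume N = 0) : nullLaw p n (lambdaVec ⁻¹' N) = 0 := by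
  have := nontrivial_sample hp hn
  obtain ⟨X₀, hX₀⟩ := exists_fderiv_tracePowers_det_ne_zero (p := p) hn
  have h1 := addHaar_image_eq_zero_of_differentiableOn_of_addHaar_eq_zero volume
    (differentiable_powerSum (min p n)).differentiableOn hN
  have h2 := measure_preimage_null_of_analytic (volume : Measure (Sample p n))
    (analyticOnNhd_tracePowers p n) (diagonalSample p n) hX₀ h1
  refine nullLaw_absolutelyContinuous hn (measure_mono_null (fun X hX => ?_) h2)
  exact ⟨lambdaVec X, hX, (tracePowers_eq X).symm⟩

theorem lambdaLaw_zero_absolutelyContinuous {p n r : ℕ} (hp : 1 ≤ p) (hn : 1 ≤ n)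
    (V : Matrix (Fin p) (Fin r) ℝ) : lambdaLaw n V 0 ≪ volume := by
  refine Measure.AbsolutelyContinuous.mk fun s hs h0 => ?_
  rw [lambdaLaw, dataLaw_zero, Measure.map_apply (measurable_lambdaVec p n) hs]
  exact nullLaw_lambdaVec_preimage hp hn h0

theorem volume_init_preimage {k : ℕ} {N : Set (Fin k → ℝ)} (hN : volume N = 0) :
    volume {z : Fin (k + 1) → ℝ | (fun i : Fin k => z i.castSucc) ∈ N} = 0 := by
  have h1 := volume_preserving_piFinSuccAbove (fun _ : Fin (k + 1) => ℝ) (Fin.last k)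
  have h2 : (volume : Measure (ℝ × (Fin k → ℝ))) (univ ×ˢ N) = 0 := by
    rw [Measure.volume_eq_prod, Measure.prod_prod, hN, mul_zero]
  refine measure_mono_null (fun z hz => ?_) (h1.quasiMeasurePreserving.preimage_null h2)
  refine ⟨mem_univ _, ?_⟩
  have h3 : (MeasurableEquiv.piFinSuccAbove (fun _ : Fin (k + 1) => ℝ) (Fin.last k) z).2 =
      fun i : Fin k => z i.castSucc := by
    funext i
    simp [MeasurableEquiv.piFinSuccAbove, Fin.insertNthEquiv, Fin.init]
  rw [h3]
  exact hz

theorem volume_ratio_preimage {m : ℕ} (hm : 1 ≤ m) {N : Set (Fin (m - 1) → ℝ)}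
    (hN : volume N = 0) : volume {x : Fin m → ℝ | ∑ i, x i ≠ 0 ∧
      (fun i : Fin (m - 1) => x (Fin.castLE (Nat.sub_le m 1) i) / ∑ i, x i) ∈ N} = 0 := by
  obtain ⟨k, rfl⟩ : ∃ k, m = k + 1 := ⟨m - 1, by omega⟩
  change Set (Fin k → ℝ) at N
  set Ψ : (Fin (k + 1) → ℝ) → Fin (k + 1) → ℝ := fun z j => z (Fin.last k) *
    Fin.lastCases (motive := fun _ => ℝ) (1 - ∑ i : Fin k, z i.castSucc)
      (fun i => z i.castSucc) j with hΨ
  have hd : Differentiable ℝ Ψ := by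
    rw [differentiable_pi]
    intro j
    refine Fin.lastCases ?_ (fun i => ?_) j
    · simp only [hΨ, Fin.lastCases_last]
      fun_prop
    · simp only [hΨ, Fin.lastCases_castSucc]
      fun_prop
  refine measure_mono_null ?_ (addHaar_image_eq_zero_of_differentiableOn_of_addHaar_eq_zero volume
    hd.differentiableOn (volume_init_preimage hN))
  rintro x ⟨hx, hxN⟩
  refine ⟨Fin.snoc (fun i : Fin k => x i.castSucc / ∑ i, x i) (∑ i, x i), ?_, ?_⟩
  · simp only [mem_ofPred_eq, Fin.snoc_castSucc]
    exact hxN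
  · funext j
    have hs := Fin.sum_univ_castSucc x
    refine Fin.lastCases ?_ (fun i => ?_) j
    · simp only [hΨ, Fin.lastCases_last, Fin.snoc_last, Fin.snoc_castSucc]
      rw [← Finset.sum_div, mul_sub, mul_div_cancel₀ _ hx, hs]
      ring
    · simp only [hΨ, Fin.lastCases_castSucc, Fin.snoc_last, Fin.snoc_castSucc]
      exact mul_div_cancel₀ _ hx

theorem muLaw_zero_absolutelyContinuous {p n r : ℕ} (hp : 1 ≤ p) (hn : 1 ≤ n)
    (V : Matrix (Fin p) (Fin r) ℝ) : muLaw n V 0 ≪ volume := by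
  refine Measure.AbsolutelyContinuous.mk fun s hs h0 => ?_
  rw [muLaw, dataLaw_zero, Measure.map_apply (measurable_muVec p n) hs]
  have h1 := nullLaw_lambdaVec_preimage hp hn (volume_ratio_preimage (le_min hp hn) h0)
  have h2 := nullLaw_ne_zero hp hn
  refine measure_mono_null (fun X hX => ?_) (measure_union_null h1 h2)
  by_cases h3 : X = 0
  · exact Or.inr (by simpa using h3)
  · have hsum : ∑ i, lambdaVec X i = eigenvalueSum X := by
      have := sum_zeroExtend_pow (min_le_left p n) (lambdaVec X) 0
      simp only [zero_add, pow_one, zeroExtend_lambdaVec] at this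
      exact this.symm
    refine Or.inl ⟨?_, ?_⟩
    · rw [hsum]
      exact (eigenvalueSum_pos hn h3).ne'
    · rw [hsum]
      exact hX

instance instIsProbabilityMeasureDataLaw {p r : ℕ} (n : ℕ) (V : Matrix (Fin p) (Fin r) ℝ)
    (h : Fin r → ℝ) : IsProbabilityMeasure (dataLaw n V h) := by
  unfold dataLaw; infer_instance

instance instIsProbabilityMeasureLambdaLaw {p r : ℕ} (n : ℕ) (V : Matrix (Fin p) (Fin r) ℝ)
    (h : Fin r → ℝ) : IsProbabilityMeasure (lambdaLaw n V h) :=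
  Measure.isProbabilityMeasure_map (measurable_lambdaVec p n).aemeasurable

instance instIsProbabilityMeasureMuLaw {p r : ℕ} (n : ℕ) (V : Matrix (Fin p) (Fin r) ℝ)
    (h : Fin r → ℝ) : IsProbabilityMeasure (muLaw n V h) :=
  Measure.isProbabilityMeasure_map (measurable_muVec p n).aemeasurable

theorem muRelDensity_muVec_of_ne_top {p n r : ℕ} (hp : 1 ≤ p) (hn : 1 ≤ n) {h : Fin r → ℝ}
    (hh : ∀ j, 0 ≤ h j) {X : Sample p n} (hX : X ≠ 0)
    (hfin : muRelDensity p n h (muVec X) ≠ ∞) :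
    IntegrableOn (fun x : ℝ => x ^ ((n : ℝ) * p / 2 - 1) * Real.exp (-((n : ℝ) / 2) * x) *
        sphericalIntegral (p * (x / eigenvalueSum X)) (spikeMatrix p n h) (eigenvalueMatrix X))
      (Ioi 0) ∧
    (muRelDensity p n h (muVec X)).toReal = (∏ j, (1 + h j) ^ (-(n : ℝ) / 2)) *
      (((n : ℝ) / 2) ^ ((n : ℝ) * p / 2) / Real.Gamma ((n : ℝ) * p / 2)) *
        ∫ x in Ioi (0 : ℝ), x ^ ((n : ℝ) * p / 2 - 1) * Real.exp (-((n : ℝ) / 2) * x) *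
          sphericalIntegral (p * (x / eigenvalueSum X)) (spikeMatrix p n h)
            (eigenvalueMatrix X) := by
  have hn0 : (0 : ℝ) < n := by exact_mod_cast hn
  have hp0 : (0 : ℝ) < p := by exact_mod_cast hp
  set w : ℝ → ℝ := fun x => x ^ ((n : ℝ) * p / 2 - 1) * Real.exp (-((n : ℝ) / 2) * x) *
    sphericalIntegral (p * (x / eigenvalueSum X)) (spikeMatrix p n h) (eigenvalueMatrix X) with hw
  set K : ℝ := (∏ j, (1 + h j) ^ (-(n : ℝ) / 2)) *
      (((n : ℝ) / 2) ^ ((n : ℝ) * p / 2) / Real.Gamma ((n : ℝ) * p / 2)) with hK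
  have hK0 : 0 < K := by
    have h1 : 0 < Real.Gamma ((n : ℝ) * p / 2) := Real.Gamma_pos_of_pos (by positivity)
    have h2 : 0 < ∏ j, (1 + h j) ^ (-(n : ℝ) / 2) :=
      Finset.prod_pos fun j _ => Real.rpow_pos_of_pos (by linarith [hh j]) _
    positivity
  have hwm : Measurable w := by
    have h1 : Measurable fun x : ℝ => sphericalIntegral (p * (x / eigenvalueSum X))
        (spikeMatrix p n h) (eigenvalueMatrix X) :=
      ((continuous_sphericalIntegral (spikeMatrix p n h)).comp
        (f := fun x : ℝ => ((p : ℝ) * (x / eigenvalueSum X), eigenvalueMatrix X))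
          (by fun_prop)).measurable
    fun_prop
  have hw0 : 0 ≤ᵐ[volume.restrict (Ioi 0)] fun x => K * w x := by
    filter_upwards [ae_restrict_mem measurableSet_Ioi] with x hx
    have hx' : (0 : ℝ) < x := hx
    exact mul_nonneg hK0.le (mul_nonneg (by positivity) (sphericalIntegral_nonneg _ _ _))
  have hmu : muRelDensity p n h (muVec X) = ∫⁻ x in Ioi (0 : ℝ), ENNReal.ofReal (K * w x) := by
    rw [muRelDensity_muVec hp hn h hX]
    refine setLIntegral_congr_fun measurableSet_Ioi fun x hx => ?_
    have hx' : (0 : ℝ) < x := hx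
    rw [gammaPDFReal, if_pos hx'.le, ← ENNReal.ofReal_mul]
    · congr 1
      simp only [hK, hw, neg_mul]
      ring
    · have h1 : 0 < Real.Gamma ((n : ℝ) * p / 2) := Real.Gamma_pos_of_pos (by positivity)
      positivity
  have hint : IntegrableOn (fun x => K * w x) (Ioi 0) :=
    ⟨(hwm.const_mul K).aestronglyMeasurable,
      (hasFiniteIntegral_iff_ofReal hw0).mpr (hmu ▸ hfin.lt_top)⟩
  refine ⟨(integrable_const_mul_iff (IsUnit.mk0 K hK0.ne') w).mp hint, ?_⟩
  rw [hmu, ← integral_const_mul, integral_eq_lintegral_of_nonneg_ae hw0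
    (hwm.const_mul K).aestronglyMeasurable]

end SpikedCovariance

theorem proposition1 {p n r : ℕ} (hp : 1 ≤ p) (hn : 1 ≤ n)
    (V : Matrix (Fin p) (Fin r) ℝ) (hV : Vᵀ * V = 1)
    (h : Fin r → ℝ) (hh : ∀ j, 0 ≤ h j) :
    -- under every parameter value, the eigenvalue vectors have Lebesgue densities
    lambdaLaw n V h ≪ volume ∧ muLaw n V h ≪ volume ∧
    lambdaLaw n V 0 ≪ volume ∧ muLaw n V 0 ≪ volume ∧
    -- the formulas hold almost surely, under the null and under every alternative
    ∀ (V' : Matrix (Fin p) (Fin r) ℝ) (h' : Fin r → ℝ), V'ᵀ * V' = 1 → (∀ j, 0 ≤ h' j) →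
      ∀ᵐ X ∂(dataLaw n V' h'),
        lambdaLR n V h (lambdaVec X) =
          (∏ j, (1 + h j) ^ (-(n : ℝ) / 2)) *
            sphericalIntegral p (spikeMatrix p n h) (eigenvalueMatrix X) ∧
        IntegrableOn (fun x : ℝ => x ^ ((n : ℝ) * p / 2 - 1) * Real.exp (-((n : ℝ) / 2) * x) *
            sphericalIntegral (p * (x / eigenvalueSum X)) (spikeMatrix p n h) (eigenvalueMatrix X))
          (Set.Ioi 0) ∧
        muLR n V h (muVec X) =
          (∏ j, (1 + h j) ^ (-(n : ℝ) / 2)) *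
            (((n : ℝ) / 2) ^ ((n : ℝ) * p / 2) / Real.Gamma ((n : ℝ) * p / 2)) *
            ∫ x in Set.Ioi (0 : ℝ),
              x ^ ((n : ℝ) * p / 2 - 1) * Real.exp (-((n : ℝ) / 2) * x) *
                sphericalIntegral (p * (x / eigenvalueSum X)) (spikeMatrix p n h)
                  (eigenvalueMatrix X) := by
  have hl := lambdaLaw_zero_absolutelyContinuous hp hn V
  have hm := muLaw_zero_absolutelyContinuous hp hn V
  have hld := lambdaLaw_eq_withDensity hp hn hV hh
  have hmd := muLaw_eq_withDensity hp hn hV hh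
  refine ⟨?_, ?_, hl, hm, fun V' h' hV' hh' => ?_⟩
  · rw [hld]
    exact (withDensity_absolutelyContinuous _ _).trans hl
  · rw [hmd]
    exact (withDensity_absolutelyContinuous _ _).trans hm
  have hac : dataLaw n V' h' ≪ nullLaw p n := by
    rw [dataLaw_eq_withDensity hn hV' hh']
    exact withDensity_absolutelyContinuous _ _
  have h1 := density_ratio_withDensity _ hl (measurable_lambdaRelDensity p n h)
  have h2 := density_ratio_withDensity _ hm (measurable_muRelDensity p n h)
  have h3 : ∀ᵐ y ∂(muLaw n V 0), muRelDensity p n h y < ⊤ := by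
    refine ae_lt_top (measurable_muRelDensity p n h) ?_
    rw [← setLIntegral_univ, ← withDensity_apply _ MeasurableSet.univ, ← hmd, measure_univ]
    exact ENNReal.one_ne_top
  rw [← hld] at h1
  rw [← hmd] at h2
  have h1' := ae_of_ae_map (measurable_lambdaVec p n).aemeasurable h1
  have h2' := ae_of_ae_map (measurable_muVec p n).aemeasurable h2
  have h3' := ae_of_ae_map (measurable_muVec p n).aemeasurable h3
  rw [dataLaw_zero] at h1' h2' h3'
  refine hac.ae_le ?_
  filter_upwards [h1', h2', h3', nullLaw_ne_zero hp hn] with X hX1 hX2 hX3 hX0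
  obtain ⟨hi, he⟩ := muRelDensity_muVec_of_ne_top hp hn hh hX0 hX3.ne
  refine ⟨?_, hi, ?_⟩
  · rw [lambdaRelDensity_lambdaVec, ENNReal.toReal_ofReal] at hX1
    · exact hX1
    · exact mul_nonneg (Finset.prod_nonneg fun j _ => Real.rpow_nonneg (by linarith [hh j]) _)
        (sphericalIntegral_nonneg _ _ _)
  · exact hX2.trans he
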